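/- Let $n\ge 0$ and $\mathbb T=\mathbb R/\mathbb Z$, with normalized Haar measure $dw$ on $\mathbb T^n$. A *Young function* is a convex $\Phi:[0,\infty]\to[0,\infty]$ with $\Phi(0)=0$ and $\lim_{t\to\infty}\Phi(t)=\Phi(\infty)=\infty$; its complementary function is $\Psi(y)=\sup_{x\ge0}(xy-\Phi(x))$. The space $L^{\Phi_1,\Phi_2}(\mathbb Z^n\times\mathbb T^n)$ consists of the measurable $F:\mathbb Z^n\times\mathbb T^n\to\mathbb C$ with $\|F\|_{L^{\Phi_1,\Phi_2}}:=\big\|\,w\mapsto\|F(\cdot,w)\|_{\ell^{\Phi_1}(\mathbb Z^n)}\big\|_{L^{\Phi_2}(\mathbb T^n)}<\infty$, where $\|h\|_{L^\Phi(\mu)}=\inf\{b>0:\int\Phi(|h|/b)\,d\mu\le1\}$ (with counting measure for $\ell^{\Phi}$). Let $\mathcal S(\mathbb Z^n)$ be the space of rapidly decreasing sequences, $\mathcal S'(\mathbb Z^n)$ its dual, and, for $g\in\mathcal S(\mathbb Z^n)$, $f\in\mathcal S'(\mathbb Z^n)$, $V_gf(m,w)=\langle f,M_wT_mg\rangle=\sum_k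 f(k)\overline{g(k-m)}e^{-2\pi i w\cdot k}$, where $M_wT_mg(k)=e^{2\pi i w\cdot k}g(k-m)$. Fix a window $0\ne g\in\mathcal S(\mathbb Z^n)$ and let $M^{\Phi_1,\Phi_2}(\mathbb Z^n)$ be the space of $f\in\mathcal S'(\mathbb Z^n)$ with $\|f\|_{M^{\Phi_1,\Phi_2}}:=\|V_gf\|_{L^{\Phi_1,\Phi_2}}<\infty$. **Theorem.** For $i=1,2$ let $\Phi_i$ be a continuous, strictly convex Young function satisfying the local $\Delta_2$-condition (there are $r>0$ and $C'$ with $\Phi_i(2x)\le C'\Phi_i(x)$ for $0\le x\le r$), let $\Psi_i$ be its complementary function, assumed to be a Young function, and suppose that there are $x_0>0$ and $C''$ with $\Psi_i(x)\le C''\Phi_i(x)$ for $0\le x\le x_0$. Then there is a constant $C<\infty$, depending only on $n,\Phi_1,\Phi_2$ and the window $g$ that defines the norm of $M^{\Phi_1,\Phi_2}(\mathbb Z^n)$, such that for all $\varsigma\in L^{\Phi_1,\Phi_2}(\mathbb Z^n\times\mathbb T^n)$ and all $g_1,g_2\in\mathcal S(\mathbb Z^n)$ the localization operator $$\mathfrak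 L^{g_1,g_2}_\varsigma f(k)=\sum_{m\in\mathbb Z^n}\int_{\mathbb T^n}\varsigma(m,w)\,V_{g_1}f(m,w)\,M_wT_mg_2(k)\,dw ,\qquad k\in\mathbb Z^n,$$ equivalently $\langle\mathfrak L^{g_1,g_2}_\varsigma f,h\rangle=\sum_m\int\varsigma\,V_{g_1}f\,\overline{V_{g_2}h}\,dw$ for $h\in\mathcal S(\mathbb Z^n)$, is well defined on $M^{\Phi_1,\Phi_2}(\mathbb Z^n)$ (the integrals converge absolutely), maps this space linearly into itself, and is bounded there with $$\big\|\mathfrak L^{g_1,g_2}_\varsigma\big\|_{\mathcal B(M^{\Phi_1,\Phi_2}(\mathbb Z^n))}\le C\,\|g_1\|_{\ell^1(\mathbb Z^n)}\,\|g_2\|_{\ell^1(\mathbb Z^n)}\,\|\varsigma\|_{L^{\Phi_1,\Phi_2}(\mathbb Z^n\times\mathbb T^n)} .$$ -/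

import Mathlib

open MeasureTheory Filter Topology
open scoped ENNReal NNReal ComplexConjugate

noncomputable section

namespace OrliczLoc

/-! ## Young functions -/

/-- A Young function: a convex map `Φ : [0, ∞] → [0, ∞]` with `Φ 0 = 0` and
`lim_{t → ∞} Φ t = Φ ∞ = ∞`. -/
structure YoungFunction where
  toFun : ℝ≥0∞ → ℝ≥0∞
  convex' : ∀ (x y : ℝ≥0∞) (a b : ℝ≥0), a + b = 1 →
    toFun (a * x + b * y) ≤ a * toFun x + b * toFun y
  map_zero' : toFun 0 = 0
  tendsto' : Tendsto (fun t : ℝ≥0 => toFun t) atTop (𝓝 ∞)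
  map_top' : toFun ∞ = ∞

instance : CoeFun YoungFunction (fun _ => ℝ≥0∞ → ℝ≥0∞) := ⟨YoungFunction.toFun⟩

/-- `Ψ` is the complementary function of `Φ`: `Ψ y = sup_{x ≥ 0} (x y - Φ x)` for `0 ≤ y < ∞`.
The subtraction is truncated at `0`, which does not change the supremum, since `x = 0`
contributes the value `0`. -/
def IsComplementary (Φ Ψ : YoungFunction) : Prop :=
  ∀ y : ℝ≥0, Ψ y = ⨆ x : ℝ≥0, ((x : ℝ≥0∞) * y - Φ x)

/-- Local `Δ₂`-condition: `Φ (2 x) ≤ C Φ x` for all `x ∈ [0, r]`, for some `r > 0` and some `C`. -/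
def LocalDelta2 (Φ : YoungFunction) : Prop :=
  ∃ r C : ℝ≥0, 0 < r ∧ ∀ x : ℝ≥0, x ≤ r → Φ (2 * x) ≤ C * Φ x

/-- Strict convexity (on the set where the function is finite). -/
def StrictlyConvex (Φ : YoungFunction) : Prop :=
  ∀ x y : ℝ≥0, x ≠ y → Φ x ≠ ∞ → Φ y ≠ ∞ → ∀ a b : ℝ≥0, 0 < a → 0 < b → a + b = 1 →
    Φ (a * x + b * y) < a * Φ x + b * Φ y

/-- `Ψ ≲ Φ` near `0`: there are `x₀ > 0` and `C` with `Ψ x ≤ C Φ x` for `0 ≤ x ≤ x₀`. -/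
def DominatedNearZero (Ψ Φ : YoungFunction) : Prop :=
  ∃ x₀ C : ℝ≥0, 0 < x₀ ∧ ∀ x : ℝ≥0, x ≤ x₀ → Ψ x ≤ C * Φ x

theorem YoungFunction.mono (Φ : YoungFunction) : Monotone Φ.toFun := by
  intro x y hxy
  rcases eq_or_ne y ∞ with rfl | hy
  · rw [Φ.map_top']; exact le_top
  rcases eq_or_ne y 0 with rfl | hy0
  · rw [nonpos_iff_eq_zero.mp hxy]
  have hx : x ≠ ∞ := ne_top_of_le_ne_top hy hxy
  lift x to ℝ≥0 using hx
  lift y to ℝ≥0 using hy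
  have hy1 : y ≠ 0 := by exact_mod_cast hy0
  have hle : x / y ≤ 1 := div_le_one_of_le₀ (by exact_mod_cast hxy) (zero_le)
  have h := Φ.convex' y 0 (x / y) (1 - x / y) (add_tsub_cancel_of_le hle)
  have e : ((x / y : ℝ≥0) : ℝ≥0∞) * y + ((1 - x / y : ℝ≥0) : ℝ≥0∞) * 0 = x := by
    rw [mul_zero, add_zero, ← ENNReal.coe_mul, div_mul_cancel₀ x hy1]
  rw [e, Φ.map_zero', mul_zero, add_zero] at h
  refine h.trans ?_
  calc ((x / y : ℝ≥0) : ℝ≥0∞) * Φ y ≤ 1 * Φ y := by gcongr; exact_mod_cast hle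
    _ = Φ y := one_mul _

/-! ## Luxemburg norms and mixed Orlicz spaces -/

/-- The Luxemburg norm `inf {b > 0 : ∫ Φ (h / b) dμ ≤ 1}` of a `[0, ∞]`-valued function, with
`inf ∅ = ∞`.  For the counting measure the integral is the sum. -/
def luxNorm {α : Type*} [MeasurableSpace α] (Φ : YoungFunction) (μ : Measure α)
    (h : α → ℝ≥0∞) : ℝ≥0∞ :=
  ⨅ (b : ℝ≥0) (_ : 0 < b) (_ : ∫⁻ x, Φ (h x / b) ∂μ ≤ 1), (b : ℝ≥0∞)

/-- The phase space `ℤⁿ × 𝕋ⁿ`, with `𝕋 = ℝ / ℤ`. -/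
abbrev Phase (n : ℕ) : Type := (Fin n → ℤ) × UnitAddTorus (Fin n)

/-- Counting measure on `ℤⁿ` times the normalized Haar measure on `𝕋ⁿ`. -/
def phaseMeasure (n : ℕ) : Measure (Phase n) :=
  (Measure.count : Measure (Fin n → ℤ)).prod (volume : Measure (UnitAddTorus (Fin n)))

/-- The norm of `L^{Φ₁, Φ₂}(ℤⁿ × 𝕋ⁿ)`: the `ℓ^{Φ₁}(ℤⁿ)` norm is taken first, for fixed `w ∈ 𝕋ⁿ`,
and then the `L^{Φ₂}(𝕋ⁿ)` norm in `w`. -/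
def mixedNorm {n : ℕ} (Φ₁ Φ₂ : YoungFunction) (F : Phase n → ℂ) : ℝ≥0∞ :=
  luxNorm Φ₂ (volume : Measure (UnitAddTorus (Fin n)))
    (fun w => luxNorm Φ₁ (Measure.count : Measure (Fin n → ℤ)) (fun k => ‖F (k, w)‖ₑ))

/-- Membership in `L^{Φ₁, Φ₂}(ℤⁿ × 𝕋ⁿ)`. -/
def MemMixedOrlicz {n : ℕ} (Φ₁ Φ₂ : YoungFunction) (F : Phase n → ℂ) : Prop :=
  AEStronglyMeasurable F (phaseMeasure n) ∧ mixedNorm Φ₁ Φ₂ F < ∞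

section Lux

variable {α : Type*} [MeasurableSpace α] {μ : Measure α}

theorem luxNorm_mono (Φ : YoungFunction) {h h' : α → ℝ≥0∞} (hh : ∀ x, h x ≤ h' x) :
    luxNorm Φ μ h ≤ luxNorm Φ μ h' := by
  refine iInf_mono fun b => iInf_mono fun hb => ?_
  refine iInf_mono' fun hi => ⟨le_trans (lintegral_mono fun x => ?_) hi, le_rfl⟩
  exact Φ.mono (ENNReal.div_le_div_right (hh x) _)

theorem luxNorm_zero (Φ : YoungFunction) : luxNorm Φ μ (fun _ => 0) = 0 := by
  refine le_antisymm ?_ zero_le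
  refine ENNReal.le_of_forall_pos_le_add fun ε hε _ => ?_
  rw [zero_add]
  refine iInf_le_of_le ε (iInf_le_of_le hε (iInf_le_of_le ?_ le_rfl))
  simp [ENNReal.zero_div, Φ.map_zero']

theorem luxNorm_add_le (Φ : YoungFunction) {h h' : α → ℝ≥0∞} (hm : AEMeasurable h μ) :
    luxNorm Φ μ (fun x => h x + h' x) ≤ luxNorm Φ μ h + luxNorm Φ μ h' := by
  unfold luxNorm
  simp only [ENNReal.iInf_add, ENNReal.add_iInf]
  refine le_iInf fun b' => le_iInf fun hb' => le_iInf fun hi' => le_iInf fun b => le_iInf fun hb =>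
    le_iInf fun hi => ?_
  refine iInf_le_of_le (b + b') (iInf_le_of_le (by positivity) (iInf_le_of_le ?_ ?_))
  swap
  · rw [ENNReal.coe_add]
  set s : ℝ≥0 := b + b' with hs
  have hs0 : s ≠ 0 := by positivity
  have hab : b / s + b' / s = 1 := by rw [← add_div, ← hs, div_self hs0]
  have key : ∀ (c : ℝ≥0), 0 < c → ∀ t : ℝ≥0∞, ((c / s : ℝ≥0) : ℝ≥0∞) * (t / c) = t / s := by
    intro c hc t
    rw [ENNReal.coe_div hs0, mul_comm, ENNReal.div_eq_inv_mul, ENNReal.div_eq_inv_mul,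
      ENNReal.div_eq_inv_mul, mul_comm _ t, mul_assoc, mul_left_comm _ _ (c : ℝ≥0∞),
      ENNReal.inv_mul_cancel (by exact_mod_cast hc.ne') ENNReal.coe_ne_top, mul_one, mul_comm]
  calc ∫⁻ x, Φ ((h x + h' x) / s) ∂μ
      ≤ ∫⁻ x, (((b / s : ℝ≥0) : ℝ≥0∞) * Φ (h x / b)
          + ((b' / s : ℝ≥0) : ℝ≥0∞) * Φ (h' x / b')) ∂μ := by
        refine lintegral_mono fun x => ?_
        have := Φ.convex' (h x / b) (h' x / b') (b / s) (b' / s) hab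
        rwa [key b hb, key b' hb', ← ENNReal.add_div] at this
    _ = ((b / s : ℝ≥0) : ℝ≥0∞) * ∫⁻ x, Φ (h x / b) ∂μ
          + ((b' / s : ℝ≥0) : ℝ≥0∞) * ∫⁻ x, Φ (h' x / b') ∂μ := by
        rw [lintegral_add_left', lintegral_const_mul' _ _ ENNReal.coe_ne_top,
          lintegral_const_mul' _ _ ENNReal.coe_ne_top]
        exact (Φ.mono.measurable.comp_aemeasurable (hm.div_const _)).const_mul _
    _ ≤ ((b / s : ℝ≥0) : ℝ≥0∞) * 1 + ((b' / s : ℝ≥0) : ℝ≥0∞) * 1 := by gcongr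
    _ = 1 := by rw [mul_one, mul_one, ← ENNReal.coe_add, hab, ENNReal.coe_one]

theorem luxNorm_const_mul_le (Φ : YoungFunction) (c : ℝ≥0) (h : α → ℝ≥0∞) :
    luxNorm Φ μ (fun x => c * h x) ≤ c * luxNorm Φ μ h := by
  rcases eq_or_ne c 0 with rfl | hc
  · simp [luxNorm_zero]
  have hc' : (c : ℝ≥0∞) ≠ 0 := by exact_mod_cast hc
  unfold luxNorm
  simp only [ENNReal.mul_iInf_of_ne hc' ENNReal.coe_ne_top]
  refine le_iInf fun b => le_iInf fun hb => le_iInf fun hi => ?_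
  refine iInf_le_of_le (c * b) (iInf_le_of_le (by positivity) (iInf_le_of_le ?_ ?_))
  · refine le_trans (le_of_eq ?_) hi
    congr with x
    rw [ENNReal.coe_mul, ENNReal.mul_div_mul_left _ _ hc' ENNReal.coe_ne_top]
  · rw [ENNReal.coe_mul]

/-- The infimum in the Luxemburg norm may be taken over rational numbers. -/
theorem luxNorm_eq_rat (Φ : YoungFunction) (h : α → ℝ≥0∞) :
    luxNorm Φ μ h = ⨅ q : {q : ℚ≥0 // 0 < q},
      if ∫⁻ x, Φ (h x / ((q.1 : ℝ≥0) : ℝ≥0∞)) ∂μ ≤ 1 then (((q.1 : ℝ≥0)) : ℝ≥0∞) else ∞ := by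
  refine le_antisymm (le_iInf fun q => ?_) ?_
  · split_ifs with hq
    · exact iInf_le_of_le (q.1 : ℝ≥0) (iInf_le_of_le (by exact_mod_cast q.2) (iInf_le_of_le hq le_rfl))
    · exact le_top
  · refine le_iInf fun b => le_iInf fun hb => le_iInf fun hi => ?_
    refine ENNReal.le_of_forall_pos_le_add fun ε hε _ => ?_
    obtain ⟨q, hbq, hqb⟩ : ∃ q : ℚ≥0, b < (q : ℝ≥0) ∧ (q : ℝ≥0) < b + ε := by
      obtain ⟨r, h1, h2⟩ := exists_rat_btwn
        (show (b : ℝ) < ((b + ε : ℝ≥0) : ℝ) by exact_mod_cast lt_add_of_pos_right b hε)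
      have hr : (0 : ℚ) ≤ r := by
        have : (0 : ℝ) ≤ (r : ℝ) := b.2.trans h1.le
        exact_mod_cast this
      lift r to ℚ≥0 using hr
      exact ⟨r, by rw [← NNReal.coe_lt_coe]; exact_mod_cast h1,
        by rw [← NNReal.coe_lt_coe]; exact_mod_cast h2⟩
    have hq0 : 0 < q := by exact_mod_cast hb.trans hbq
    refine iInf_le_of_le ⟨q, hq0⟩ ?_
    rw [if_pos]
    · exact_mod_cast hqb.le
    · refine le_trans (lintegral_mono fun x => Φ.mono ?_) hi
      exact ENNReal.div_le_div_left (by exact_mod_cast hbq.le) _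

end Lux

theorem aemeasurable_slice {n : ℕ} {F : Phase n → ℂ}
    (hF : AEStronglyMeasurable F (phaseMeasure n)) (k : Fin n → ℤ) :
    AEMeasurable (fun w => ‖F (k, w)‖ₑ) (volume : Measure (UnitAddTorus (Fin n))) := by
  have h := hF.prodMk_left
  rw [Measure.ae_count_iff] at h
  exact (h k).enorm

theorem aemeasurable_innerNorm {n : ℕ} (Φ : YoungFunction) {F : Phase n → ℂ}
    (hF : AEStronglyMeasurable F (phaseMeasure n)) :
    AEMeasurable (fun w => luxNorm Φ (Measure.count : Measure (Fin n → ℤ))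
      (fun k => ‖F (k, w)‖ₑ)) (volume : Measure (UnitAddTorus (Fin n))) := by
  simp only [luxNorm_eq_rat]
  refine AEMeasurable.iInf fun q => ?_
  have hm : Measurable (fun s : ℝ≥0∞ =>
      if s ≤ 1 then (((q.1 : ℝ≥0)) : ℝ≥0∞) else ∞) :=
    Measurable.ite measurableSet_Iic measurable_const measurable_const
  refine hm.comp_aemeasurable ?_
  simp only [lintegral_count]
  exact AEMeasurable.tsum fun k =>
    Φ.mono.measurable.comp_aemeasurable ((aemeasurable_slice hF k).div_const _)

theorem mixedNorm_add_le {n : ℕ} (Φ₁ Φ₂ : YoungFunction) {F G : Phase n → ℂ}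
    (hF : AEStronglyMeasurable F (phaseMeasure n)) :
    mixedNorm Φ₁ Φ₂ (F + G) ≤ mixedNorm Φ₁ Φ₂ F + mixedNorm Φ₁ Φ₂ G := by
  refine le_trans (luxNorm_mono Φ₂ fun w => ?_)
    (luxNorm_add_le Φ₂ (aemeasurable_innerNorm Φ₁ hF))
  refine le_trans (luxNorm_mono Φ₁ fun k => ?_) (luxNorm_add_le Φ₁ ?_)
  · exact enorm_add_le _ _
  · exact (measurable_of_countable _).aemeasurable

theorem mixedNorm_smul_le {n : ℕ} (Φ₁ Φ₂ : YoungFunction) (c : ℂ) (F : Phase n → ℂ) :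
    mixedNorm Φ₁ Φ₂ (c • F) ≤ ‖c‖ₑ * mixedNorm Φ₁ Φ₂ F := by
  refine le_trans (luxNorm_mono Φ₂ fun w => ?_) (luxNorm_const_mul_le Φ₂ ‖c‖₊ _)
  refine le_trans (luxNorm_mono Φ₁ fun k => ?_) (luxNorm_const_mul_le Φ₁ ‖c‖₊ _)
  rw [Pi.smul_apply, enorm_smul]
  exact le_rfl

theorem mixedNorm_zero {n : ℕ} (Φ₁ Φ₂ : YoungFunction) :
    mixedNorm Φ₁ Φ₂ (0 : Phase n → ℂ) = 0 := by
  simp [mixedNorm, luxNorm_zero]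

/-! ## The Schwartz space on `ℤⁿ` and tempered distributions -/

/-- Rapidly decreasing functions on `ℤⁿ`; `‖k‖` is the maximum norm, which is equivalent to any
other norm on `ℤⁿ`. -/
def schwartzSubmodule (n : ℕ) : Submodule ℂ ((Fin n → ℤ) → ℂ) where
  carrier := {g | ∀ j : ℕ, ∃ C : ℝ, ∀ k, (1 + ‖k‖) ^ j * ‖g k‖ ≤ C}
  zero_mem' := fun j => ⟨0, fun k => by simp⟩
  add_mem' := by
    intro g h hg hh j
    obtain ⟨C, hC⟩ := hg j
    obtain ⟨D, hD⟩ := hh j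
    refine ⟨C + D, fun k => ?_⟩
    calc (1 + ‖k‖) ^ j * ‖g k + h k‖ ≤ (1 + ‖k‖) ^ j * (‖g k‖ + ‖h k‖) := by
          gcongr; exact norm_add_le _ _
      _ ≤ C + D := by rw [mul_add]; exact add_le_add (hC k) (hD k)
  smul_mem' := by
    intro c g hg j
    obtain ⟨C, hC⟩ := hg j
    refine ⟨‖c‖ * C, fun k => ?_⟩
    calc (1 + ‖k‖) ^ j * ‖c • g k‖ = ‖c‖ * ((1 + ‖k‖) ^ j * ‖g k‖) := by
          rw [norm_smul]; ring
      _ ≤ ‖c‖ * C := by gcongr; exact hC k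

/-- The Schwartz space `𝒮(ℤⁿ)`. -/
def SchwartzZ (n : ℕ) : Type := ↥(schwartzSubmodule n)

namespace SchwartzZ

variable {n : ℕ}

instance : AddCommGroup (SchwartzZ n) := inferInstanceAs (AddCommGroup ↥(schwartzSubmodule n))

instance : Module ℂ (SchwartzZ n) := inferInstanceAs (Module ℂ ↥(schwartzSubmodule n))

instance : CoeFun (SchwartzZ n) (fun _ => (Fin n → ℤ) → ℂ) := ⟨Subtype.val⟩

/-- The seminorm `p_j g = sup_k (1 + |k|)^j |g k|`. -/
def seminorm (n : ℕ) (j : ℕ) : Seminorm ℂ (SchwartzZ n) :=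
  Seminorm.ofSMulLE (fun g => ⨆ k, (1 + ‖k‖) ^ j * ‖g k‖)
    (by
      have : ∀ k : Fin n → ℤ, (1 + ‖k‖) ^ j * ‖(0 : SchwartzZ n) k‖ = 0 := fun k => by
        have h0 : (0 : SchwartzZ n) k = 0 := rfl
        rw [h0, norm_zero, mul_zero]
      simp only [this]; exact ciSup_const)
    (by
      intro g h
      have hb : ∀ u : SchwartzZ n, BddAbove (Set.range fun k => (1 + ‖k‖) ^ j * ‖u k‖) := by
        intro u
        obtain ⟨C, hC⟩ := u.2 j
        exact ⟨C, by rintro _ ⟨k, rfl⟩; exact hC k⟩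
      refine ciSup_le fun k => ?_
      have h1 := le_ciSup (hb g) k
      have h2 := le_ciSup (hb h) k
      calc (1 + ‖k‖) ^ j * ‖(g + h) k‖ ≤ (1 + ‖k‖) ^ j * (‖g k‖ + ‖h k‖) := by
            gcongr; exact norm_add_le (g k) (h k)
        _ ≤ _ := by rw [mul_add]; exact add_le_add h1 h2)
    (by
      intro c g
      obtain ⟨C, hC⟩ := g.2 j
      have hb : BddAbove (Set.range fun k => (1 + ‖k‖) ^ j * ‖g k‖) :=
        ⟨C, by rintro _ ⟨k, rfl⟩; exact hC k⟩
      refine ciSup_le fun k => ?_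
      have e : (c • g) k = c * g k := rfl
      calc (1 + ‖k‖) ^ j * ‖(c • g) k‖ = ‖c‖ * ((1 + ‖k‖) ^ j * ‖g k‖) := by
            rw [e, norm_mul]; ring
        _ ≤ _ := by gcongr; exact le_ciSup hb k)

/-- The topology of `𝒮(ℤⁿ)` is the one generated by the seminorms `p_j`. -/
instance : TopologicalSpace (SchwartzZ n) :=
  (show SeminormFamily ℂ (SchwartzZ n) ℕ from seminorm n).moduleFilterBasis.topology

/-- Complex conjugation on `𝒮(ℤⁿ)`. -/
def conjS (g : SchwartzZ n) : SchwartzZ n :=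
  ⟨fun k => conj (g k), fun j => by
    obtain ⟨C, hC⟩ := g.2 j
    exact ⟨C, fun k => by rw [RCLike.norm_conj]; exact hC k⟩⟩

/-- The time-frequency shift `M_w T_m g`, i.e. `k ↦ e^{2 π i w · k} g (k - m)`. -/
def tfShift (p : Phase n) (g : SchwartzZ n) : SchwartzZ n :=
  ⟨fun k => UnitAddTorus.mFourier k p.2 * g (k - p.1), fun j => by
    obtain ⟨C, hC⟩ := g.2 j
    refine ⟨(1 + ‖p.1‖) ^ j * C, fun k => ?_⟩
    have h1 : ‖UnitAddTorus.mFourier k p.2‖ ≤ 1 :=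
      ((UnitAddTorus.mFourier k).norm_coe_le_norm p.2).trans UnitAddTorus.mFourier_norm.le
    have h2 : 1 + ‖k‖ ≤ (1 + ‖p.1‖) * (1 + ‖k - p.1‖) := by
      have h3 : ‖k‖ ≤ ‖k - p.1‖ + ‖p.1‖ := by
        simpa using norm_add_le (k - p.1) p.1
      nlinarith [norm_nonneg p.1, norm_nonneg (k - p.1),
        mul_nonneg (norm_nonneg p.1) (norm_nonneg (k - p.1))]
    calc (1 + ‖k‖) ^ j * ‖UnitAddTorus.mFourier k p.2 * g (k - p.1)‖
        ≤ ((1 + ‖p.1‖) * (1 + ‖k - p.1‖)) ^ j * (1 * ‖g (k - p.1)‖) := by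
          rw [norm_mul]; gcongr
      _ = (1 + ‖p.1‖) ^ j * ((1 + ‖k - p.1‖) ^ j * ‖g (k - p.1)‖) := by
          rw [mul_pow]; ring
      _ ≤ (1 + ‖p.1‖) ^ j * C := by gcongr; exact hC _⟩

/-- The unit sequence `δ_k`. -/
def delta (k : Fin n → ℤ) : SchwartzZ n :=
  ⟨Pi.single k 1, fun j => by
    refine ⟨(1 + ‖k‖) ^ j, fun l => ?_⟩
    rcases eq_or_ne l k with rfl | h
    · simp
    · simp only [Pi.single_eq_of_ne h, norm_zero, mul_zero]
      positivity⟩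

/-- The `ℓ¹(ℤⁿ)` norm. -/
def l1Norm (g : SchwartzZ n) : ℝ≥0∞ := ∑' k, ‖g k‖ₑ

/-- The short-time Fourier transform of a rapidly decreasing sequence,
`V_g h (m, w) = ∑_k h k · conj (M_w T_m g k) = ∑_k h k · conj (g (k - m)) · e^{-2 π i w · k}`. -/
def stft (g h : SchwartzZ n) (p : Phase n) : ℂ := ∑' k, h k * conj (tfShift p g k)

end SchwartzZ

/-- Tempered distributions on `ℤⁿ`: continuous linear functionals on `𝒮(ℤⁿ)`.  The value of the
distribution `f` at the point `k ∈ ℤⁿ` is `f δ_k`. -/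
abbrev TemperedZ (n : ℕ) : Type := SchwartzZ n →L[ℂ] ℂ

/-- The sesquilinear pairing `⟨f, h⟩`, which is `∑_k f k · conj (h k)` when `f` is a function. -/
def TemperedZ.pairing {n : ℕ} (f : TemperedZ n) (h : SchwartzZ n) : ℂ := f h.conjS

/-- The short-time Fourier transform `V_g f (m, w) = ⟨f, M_w T_m g⟩` of a tempered distribution. -/
def stft {n : ℕ} (g : SchwartzZ n) (f : TemperedZ n) (p : Phase n) : ℂ :=
  f.pairing (g.tfShift p)

/-! ## Orlicz modulation spaces and localization operators -/

/-- The Orlicz modulation space `M^{Φ₁, Φ₂}(ℤⁿ)`, with respect to the window `g`: all tempered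
distributions `f` with `V_g f ∈ L^{Φ₁, Φ₂}(ℤⁿ × 𝕋ⁿ)`. -/
def modulationSpace {n : ℕ} (Φ₁ Φ₂ : YoungFunction) (g : SchwartzZ n) :
    Submodule ℂ (TemperedZ n) where
  carrier := {f | MemMixedOrlicz Φ₁ Φ₂ (stft g f)}
  zero_mem' := by
    have h : stft g (0 : TemperedZ n) = 0 := rfl
    rw [Set.mem_ofPred_eq, h]
    exact ⟨aestronglyMeasurable_const, by rw [mixedNorm_zero]; exact ENNReal.zero_lt_top⟩
  add_mem' := by
    intro f f' hf hf'
    have h : stft g (f + f') = stft g f + stft g f' := rfl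
    rw [Set.mem_ofPred_eq, h]
    exact ⟨hf.1.add hf'.1,
      (mixedNorm_add_le Φ₁ Φ₂ hf.1).trans_lt (ENNReal.add_lt_top.mpr ⟨hf.2, hf'.2⟩)⟩
  smul_mem' := by
    intro c f hf
    have h : stft g (c • f) = c • stft g f := rfl
    rw [Set.mem_ofPred_eq, h]
    exact ⟨hf.1.const_smul c,
      (mixedNorm_smul_le Φ₁ Φ₂ c _).trans_lt (ENNReal.mul_lt_top enorm_lt_top hf.2)⟩

/-- The norm `‖f‖_{M^{Φ₁, Φ₂}(ℤⁿ)} = ‖V_g f‖_{L^{Φ₁, Φ₂}(ℤⁿ × 𝕋ⁿ)}`. -/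
def modulationNorm {n : ℕ} (Φ₁ Φ₂ : YoungFunction) (g : SchwartzZ n) (f : TemperedZ n) : ℝ≥0∞ :=
  mixedNorm Φ₁ Φ₂ (stft g f)

/-- `u` is the image of `f` under the localization operator with symbol `ς` and windows `g₁, g₂`:
the integrals over `ℤⁿ × 𝕋ⁿ` (that is, `∑_m ∫ dw`) below converge absolutely and
* `u k = ∑_m ∫ ς (m, w) · V_{g₁} f (m, w) · M_w T_m g₂ k dw` for all `k ∈ ℤⁿ`,
* `⟨u, h⟩ = ∑_m ∫ ς (m, w) · V_{g₁} f (m, w) · conj (V_{g₂} h (m, w)) dw` for all `h ∈ 𝒮(ℤⁿ)`. -/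
def IsLocalizationOf {n : ℕ} (ς : Phase n → ℂ) (g₁ g₂ : SchwartzZ n) (f u : TemperedZ n) : Prop :=
  (∀ k : Fin n → ℤ,
    Integrable (fun p => ς p * stft g₁ f p * g₂.tfShift p k) (phaseMeasure n) ∧
    u (SchwartzZ.delta k) = ∫ p, ς p * stft g₁ f p * g₂.tfShift p k ∂(phaseMeasure n)) ∧
  (∀ h : SchwartzZ n,
    Integrable (fun p => ς p * stft g₁ f p * conj (SchwartzZ.stft g₂ h p)) (phaseMeasure n) ∧
    u.pairing h =
      ∫ p, ς p * stft g₁ f p * conj (SchwartzZ.stft g₂ h p) ∂(phaseMeasure n))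

end OrliczLoc

end

noncomputable section

namespace OrliczLoc

/-! The torus has total mass 1 and `Φ₂` is continuous, so L^{Φ₂}(𝕋ⁿ) contains the constants and
embeds into L¹(𝕋ⁿ). Hence the norm of M^{Φ₁,Φ₂}(ℤⁿ) is equivalent to the ℓ^{Φ₁} norm of the sequence
f(δ_k), called `seqNorm`. For the upper bound (`exists_modulationNorm_le`), |V_g f(m, w)| is at most
∑_j |f(m + j)| |g(j)| for every w, and Young's convolution inequality applies. For the lower bound
(`exists_seqNorm_le`), f(m + j) · conj g(j) is a Fourier coefficient of V_g f(m, ·), hence at most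
its L¹(𝕋ⁿ) norm; fix j with g(j) ≠ 0 and exchange the ℓ^{Φ₁} norm with the integral by Minkowski's
inequality.

On sequences the operator is easy to bound (`exists_isLocalizationOf`). Since ℓ^{Φ₁} embeds into
ℓ^∞, V_{g₁} f is bounded by a multiple of ‖f‖ ‖g₁‖₁. By Minkowski again, a(m) = ∫ |ς(m, w)| dw lies
in ℓ^{Φ₁}. The image of f is then dominated by a multiple of the convolution of a with |g₂|, and
Young's inequality finishes.

Minkowski's and Young's inequalities are two cases of one modular inequality,
`tsum_lintegral_div_le_one`. It comes from linear minorants of Φ instead of duality, at the cost of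
a factor 2. -/

/-! ### Linear minorants of Young functions -/

theorem YoungFunction.div_mul_le (Φ : YoungFunction) {c : ℝ≥0} (hc : c ≠ 0) {u : ℝ≥0∞}
    (hu : c ≤ u) : u / c * Φ c ≤ Φ u := by
  rcases eq_or_ne u ∞ with rfl | hu'
  · rw [Φ.map_top']; exact le_top
  lift u to ℝ≥0 using hu'
  have hcu : c ≤ u := by exact_mod_cast hu
  have hu0 : u ≠ 0 := (lt_of_lt_of_le (pos_iff_ne_zero.mpr hc) hcu).ne'
  have h := Φ.convex' u 0 (c / u) (1 - c / u)
    (add_tsub_cancel_of_le (div_le_one_of_le₀ hcu zero_le))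
  have e : ((c / u : ℝ≥0) : ℝ≥0∞) * u = c := by
    rw [← ENNReal.coe_mul, div_mul_cancel₀ c hu0]
  rw [e, mul_zero, add_zero, Φ.map_zero', mul_zero, add_zero] at h
  calc (u : ℝ≥0∞) / c * Φ c ≤ (u : ℝ≥0∞) / c * (((c / u : ℝ≥0) : ℝ≥0∞) * Φ u) := by gcongr
    _ = ((u / c * (c / u) : ℝ≥0) : ℝ≥0∞) * Φ u := by
        rw [← ENNReal.coe_div hc, ENNReal.coe_mul, mul_assoc]
    _ = Φ u := by
        rw [div_mul_div_cancel₀ hc, div_self hu0, ENNReal.coe_one, one_mul]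

/-- Convexity and Φ 0 = 0 make Φ(u) / u nondecreasing, so beyond c the chord from the origin to (c,
Φ c) lies below Φ. Truncated subtraction makes the bound trivial before c. -/
theorem YoungFunction.sub_mul_le (Φ : YoungFunction) {c : ℝ≥0} (hc : c ≠ 0) (u : ℝ≥0∞) :
    (u - c) * ((c : ℝ≥0∞)⁻¹ * Φ c) ≤ Φ u := by
  rcases le_total u c with h | h
  · rw [tsub_eq_zero_of_le h, zero_mul]; exact zero_le
  · refine le_trans ?_ (Φ.div_mul_le hc h)
    rw [ENNReal.div_eq_inv_mul, mul_comm _ u, mul_assoc]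
    gcongr
    exact tsub_le_self

/-- The perspective of a Young function is bounded below by a linear function. -/
theorem YoungFunction.perspective_le (Φ : YoungFunction) {c : ℝ≥0} (hc : c ≠ 0) {h M : ℝ≥0∞}
    (hM : M ≠ ∞) (hhM : h / M ≠ ∞) :
    (h - c * M) * ((c : ℝ≥0∞)⁻¹ * Φ c) ≤ M * Φ (h / M) := by
  have e : h = M * (h / M) := by
    rcases eq_or_ne M 0 with rfl | hM0
    · rw [zero_mul]
      by_contra h0
      exact hhM (ENNReal.div_zero h0)
    · rw [ENNReal.mul_div_cancel hM0 hM]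
  calc (h - c * M) * ((c : ℝ≥0∞)⁻¹ * Φ c)
      = M * ((h / M - c) * ((c : ℝ≥0∞)⁻¹ * Φ c)) := by
        nth_rewrite 1 [e]
        rw [mul_comm (c : ℝ≥0∞) M, ← ENNReal.mul_sub fun _ _ => hM, mul_assoc]
    _ ≤ M * Φ (h / M) := by gcongr; exact Φ.sub_mul_le hc _

theorem YoungFunction.exists_one_le (Φ : YoungFunction) : ∃ t : ℝ≥0, 0 < t ∧ 1 ≤ Φ t := by
  have h := (Φ.tendsto'.eventually (lt_mem_nhds ENNReal.one_lt_top)).and (eventually_gt_atTop 0)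
  obtain ⟨t, h1, h2⟩ := h.exists
  exact ⟨t, h2, h1.le⟩

/-- Continuity at 0 excludes Φ = ∞ on (0, ∞), for which no nonzero constant has finite Luxemburg
norm on a probability space. -/
theorem YoungFunction.exists_le_one (Φ : YoungFunction) (hΦ : Continuous Φ.toFun) :
    ∃ t : ℝ≥0, 0 < t ∧ Φ t ≤ 1 := by
  have h : Tendsto (fun t : ℝ≥0 => Φ t) (𝓝 0) (𝓝 0) := by
    have := (hΦ.comp ENNReal.continuous_coe).tendsto (0 : ℝ≥0)
    simpa [Function.comp_def, Φ.map_zero'] using this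
  have h1 : ∀ᶠ t : ℝ≥0 in 𝓝[>] 0, Φ t < 1 :=
    (h.eventually (gt_mem_nhds one_pos)).filter_mono nhdsWithin_le_nhds
  obtain ⟨t, h2, h3⟩ := (h1.and self_mem_nhdsWithin).exists
  exact ⟨t, h3, h2.le⟩

/-- At least linear growth of Φ beyond t. This yields both the embedding into L¹ and the one into
ℓ^∞. -/
theorem YoungFunction.le_add_mul (Φ : YoungFunction) {t : ℝ≥0} (ht : 0 < t) (h1 : 1 ≤ Φ t)
    (u : ℝ≥0∞) : u ≤ t + t * Φ u := by
  rcases le_total u t with h | h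
  · exact h.trans le_self_add
  · have h0 : (t : ℝ≥0∞) ≠ 0 := by exact_mod_cast ht.ne'
    calc u = t * (u / t * 1) := by rw [mul_one, ENNReal.mul_div_cancel h0 ENNReal.coe_ne_top]
      _ ≤ t * (u / t * Φ t) := by gcongr
      _ ≤ t * Φ u := by gcongr; exact Φ.div_mul_le ht.ne' h
      _ ≤ t + t * Φ u := le_add_self

/-! ### Embeddings, Minkowski's and Young's inequalities for Luxemburg norms -/

section

variable {α : Type*} [MeasurableSpace α] {μ : Measure α}

theorem luxNorm_le (Φ : YoungFunction) {h : α → ℝ≥0∞} {b : ℝ≥0} (hb : 0 < b)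
    (hi : ∫⁻ x, Φ (h x / b) ∂μ ≤ 1) : luxNorm Φ μ h ≤ b :=
  iInf_le_of_le b (iInf_le_of_le hb (iInf_le_of_le hi le_rfl))

theorem lintegral_le_one_of_luxNorm_lt (Φ : YoungFunction) {h : α → ℝ≥0∞} {b : ℝ≥0∞}
    (hb : luxNorm Φ μ h < b) : ∫⁻ x, Φ (h x / b) ∂μ ≤ 1 := by
  simp only [luxNorm, iInf_lt_iff] at hb
  obtain ⟨b', _, hi, hb'⟩ := hb
  exact le_trans (lintegral_mono fun x => Φ.mono (ENNReal.div_le_div_left hb'.le _)) hi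

/-- C ≠ 0 matters when no b is admissible: then `H` is void and the norm is ∞, but 0 * ∞ = 0. -/
theorem le_mul_luxNorm {Φ : YoungFunction} {h : α → ℝ≥0∞} {C : ℝ≥0} (hC : C ≠ 0) {x : ℝ≥0∞}
    (H : ∀ b : ℝ≥0, 0 < b → ∫⁻ x, Φ (h x / b) ∂μ ≤ 1 → x ≤ C * b) : x ≤ C * luxNorm Φ μ h := by
  have hC' : (C : ℝ≥0∞) ≠ 0 := by exact_mod_cast hC
  unfold luxNorm
  simp only [ENNReal.mul_iInf_of_ne hC' ENNReal.coe_ne_top]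
  exact le_iInf fun b => le_iInf fun hb => le_iInf fun hi => H b hb hi

/-- On a probability space, the Orlicz space embeds into `L¹`. -/
theorem exists_lintegral_le_mul_luxNorm (Φ : YoungFunction) :
    ∃ K : ℝ≥0, ∀ {α : Type} [MeasurableSpace α] (μ : Measure α) [IsProbabilityMeasure μ]
      (h : α → ℝ≥0∞), ∫⁻ x, h x ∂μ ≤ K * luxNorm Φ μ h := by
  obtain ⟨t, ht, h1⟩ := Φ.exists_one_le
  -- The modular of h / b is at most 1 and μ has mass 1, so t + t Φ(h / b) integrates to at most 2
  -- t.
  refine ⟨2 * t, fun μ _ h => le_mul_luxNorm (by positivity) fun b hb hi => ?_⟩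
  have hb0 : (b : ℝ≥0∞) ≠ 0 := by exact_mod_cast hb.ne'
  calc ∫⁻ x, h x ∂μ = ∫⁻ x, b * (h x / b) ∂μ := by
        simp only [ENNReal.mul_div_cancel hb0 ENNReal.coe_ne_top]
    _ = b * ∫⁻ x, h x / b ∂μ := lintegral_const_mul' _ _ ENNReal.coe_ne_top
    _ ≤ b * ∫⁻ x, (t + t * Φ (h x / b)) ∂μ := by gcongr with x; exact Φ.le_add_mul ht h1 _
    _ = b * (t + t * ∫⁻ x, Φ (h x / b) ∂μ) := by
        rw [lintegral_add_left measurable_const, lintegral_const_mul' _ _ ENNReal.coe_ne_top]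
        simp
    _ ≤ b * (t + t * 1) := by gcongr
    _ = ((2 * t : ℝ≥0) : ℝ≥0∞) * b := by push_cast; ring

/-- `ℓ^Φ` embeds into `ℓ^∞`. -/
theorem exists_le_mul_luxNorm_count (Φ : YoungFunction) :
    ∃ K : ℝ≥0, ∀ {ι : Type} [MeasurableSpace ι] [MeasurableSingletonClass ι]
      (h : ι → ℝ≥0∞) (i : ι), h i ≤ K * luxNorm Φ Measure.count h := by
  obtain ⟨t, ht, h1⟩ := Φ.exists_one_le
  refine ⟨2 * t, fun h i => le_mul_luxNorm (by positivity) fun b hb hi => ?_⟩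
  rw [lintegral_count] at hi
  have hb0 : (b : ℝ≥0∞) ≠ 0 := by exact_mod_cast hb.ne'
  calc h i = b * (h i / b) := (ENNReal.mul_div_cancel hb0 ENNReal.coe_ne_top).symm
    _ ≤ b * (t + t * Φ (h i / b)) := by gcongr; exact Φ.le_add_mul ht h1 _
    _ ≤ b * (t + t * 1) := by
        gcongr
        exact (ENNReal.le_tsum (f := fun i => Φ (h i / b)) i).trans hi
    _ = ((2 * t : ℝ≥0) : ℝ≥0∞) * b := by push_cast; ring

/-- The choice b = c / t with Φ t ≤ 1 makes the modular equal to Φ t on a probability space. -/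
theorem exists_luxNorm_const_le (Φ : YoungFunction) (hΦ : Continuous Φ.toFun) :
    ∃ K : ℝ≥0, ∀ {α : Type} [MeasurableSpace α] (μ : Measure α) [IsProbabilityMeasure μ]
      (c : ℝ≥0∞), luxNorm Φ μ (fun _ => c) ≤ K * c := by
  obtain ⟨t, ht, h1⟩ := Φ.exists_le_one hΦ
  have ht0 : (t : ℝ≥0∞) ≠ 0 := by exact_mod_cast ht.ne'
  have hK : t⁻¹ ≠ 0 := by positivity
  refine ⟨t⁻¹, fun μ _ c => ?_⟩
  rcases eq_or_ne c ∞ with rfl | hc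
  · rw [ENNReal.mul_top (by exact_mod_cast hK)]; exact le_top
  lift c to ℝ≥0 using hc
  rcases eq_or_ne c 0 with rfl | hc0
  · simp [luxNorm_zero]
  rw [← ENNReal.coe_mul]
  refine luxNorm_le Φ (by positivity) ?_
  have e : (c : ℝ≥0∞) / ((t⁻¹ * c : ℝ≥0) : ℝ≥0∞) = t := by
    rw [← ENNReal.coe_div (by positivity)]
    congr 1
    field_simp
  simp only [e]
  simpa using h1

/-- Minkowski's integral inequality for the modular of a Young function, with constant `2`. -/
theorem tsum_lintegral_div_le_one (Φ : YoungFunction) {ι : Type*} [Countable ι]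
    {h : ι → α → ℝ≥0∞} {M : α → ℝ≥0∞} (hh : ∀ i, AEMeasurable (h i) μ) (hM : AEMeasurable M μ)
    {B : ℝ≥0} (hB : 0 < B) (hMB : ∫⁻ x, M x ∂μ ≤ B)
    (hs : ∀ᵐ x ∂μ, M x ≠ ∞ → ∑' i, Φ (h i x / M x) ≤ 1) :
    ∑' i, Φ ((∫⁻ x, h i x ∂μ) / ((2 * B : ℝ≥0) : ℝ≥0∞)) ≤ 1 := by
  have hB0 : (B : ℝ≥0∞) ≠ 0 := by exact_mod_cast hB.ne'
  have hMfin : ∀ᵐ x ∂μ, M x ≠ ∞ :=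
    (ae_lt_top' hM (ne_top_of_le_ne_top ENNReal.coe_ne_top hMB)).mono fun _ h => h.ne
  have hs' : ∀ᵐ x ∂μ, ∑' i, Φ (h i x / M x) ≤ 1 := by
    filter_upwards [hs, hMfin] with x h1 h2 using h1 h2
  obtain ⟨t, ht, h1t⟩ := Φ.exists_one_le
  have key : ∀ i, B * Φ ((∫⁻ x, h i x ∂μ) / ((2 * B : ℝ≥0) : ℝ≥0∞))
      ≤ ∫⁻ x, M x * Φ (h i x / M x) ∂μ := by
    intro i
    have hle : ∀ᵐ x ∂μ, Φ (h i x / M x) ≤ 1 := by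
      filter_upwards [hs'] with x hx
      exact (ENNReal.le_tsum (f := fun i => Φ (h i x / M x)) i).trans hx
    -- Each term of a sum bounded by 1 is bounded by 1, which bounds h i / M. This makes ∫ h i
    -- finite and forces h i = 0 where M = 0.
    have hdiv : ∀ᵐ x ∂μ, h i x / M x ≤ 2 * t := by
      filter_upwards [hle] with x hx
      calc h i x / M x ≤ t + t * Φ (h i x / M x) := Φ.le_add_mul ht h1t _
        _ ≤ t + t * 1 := by gcongr
        _ = 2 * t := by ring
    have hfin : ∫⁻ x, h i x ∂μ ≠ ∞ := by
      refine ne_top_of_le_ne_top (b := 2 * t * B) ?_ ?_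
      · exact ENNReal.mul_ne_top (ENNReal.mul_ne_top (by simp) ENNReal.coe_ne_top)
          ENNReal.coe_ne_top
      · calc ∫⁻ x, h i x ∂μ ≤ ∫⁻ x, 2 * t * M x ∂μ := by
              refine lintegral_mono_ae ?_
              filter_upwards [hdiv, hMfin] with x h1 h2
              refine (ENNReal.div_le_iff_le_mul (Or.inr ?_) (Or.inl h2)).mp h1
              exact ENNReal.mul_ne_top (by simp) ENNReal.coe_ne_top
          _ = 2 * t * ∫⁻ x, M x ∂μ :=
              lintegral_const_mul' _ _ (ENNReal.mul_ne_top (by simp) ENNReal.coe_ne_top)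
          _ ≤ 2 * t * B := by gcongr
    obtain ⟨c, hc⟩ : ∃ c : ℝ≥0, (c : ℝ≥0∞) = (∫⁻ x, h i x ∂μ) / ((2 * B : ℝ≥0) : ℝ≥0∞) :=
      ⟨_, ENNReal.coe_toNNReal (ENNReal.div_ne_top hfin (by simpa using hB0))⟩
    have hint : ∫⁻ x, h i x ∂μ = c * B + c * B := by
      rw [ENNReal.eq_div_iff (by simpa using hB0) ENNReal.coe_ne_top] at hc
      rw [← hc]; push_cast; ring
    rw [← hc]
    rcases eq_or_ne c 0 with rfl | hc0
    · simp [Φ.map_zero']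
    have hc0' : (c : ℝ≥0∞) ≠ 0 := by exact_mod_cast hc0
    -- This is where the factor 2 is spent: ∫ h i = 2cB, so after subtracting c ∫ M ≤ cB at least cB
    -- remains. The linear minorant through c, applied to h i / M and integrated with weight M, then
    -- bounds B Φ(c).
    calc B * Φ c = (c * B) * ((c : ℝ≥0∞)⁻¹ * Φ c) := by
          rw [mul_mul_mul_comm, ENNReal.mul_inv_cancel hc0' ENNReal.coe_ne_top, one_mul]
      _ = (∫⁻ x, h i x ∂μ - c * B) * ((c : ℝ≥0∞)⁻¹ * Φ c) := by
          rw [hint, ENNReal.add_sub_cancel_right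
            (ENNReal.mul_ne_top ENNReal.coe_ne_top ENNReal.coe_ne_top)]
      _ ≤ (∫⁻ x, h i x ∂μ - ∫⁻ x, c * M x ∂μ) * ((c : ℝ≥0∞)⁻¹ * Φ c) := by
          rw [lintegral_const_mul' _ _ ENNReal.coe_ne_top]
          gcongr
      _ ≤ (∫⁻ x, (h i x - c * M x) ∂μ) * ((c : ℝ≥0∞)⁻¹ * Φ c) := by
          gcongr
          exact lintegral_sub_le' _ _ (hM.const_mul _)
      _ = ∫⁻ x, (h i x - c * M x) * ((c : ℝ≥0∞)⁻¹ * Φ c) ∂μ :=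
          (lintegral_mul_const'' _ ((hh i).sub (hM.const_mul _))).symm
      _ ≤ ∫⁻ x, M x * Φ (h i x / M x) ∂μ := by
          refine lintegral_mono_ae ?_
          filter_upwards [hdiv, hMfin] with x h1 h2
          refine Φ.perspective_le hc0 h2 (ne_top_of_le_ne_top ?_ h1)
          exact ENNReal.mul_ne_top (by simp) ENNReal.coe_ne_top
  have hsum : B * ∑' i, Φ ((∫⁻ x, h i x ∂μ) / ((2 * B : ℝ≥0) : ℝ≥0∞)) ≤ B * 1 := by
    calc B * ∑' i, Φ ((∫⁻ x, h i x ∂μ) / ((2 * B : ℝ≥0) : ℝ≥0∞))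
        = ∑' i, B * Φ ((∫⁻ x, h i x ∂μ) / ((2 * B : ℝ≥0) : ℝ≥0∞)) := ENNReal.tsum_mul_left.symm
      _ ≤ ∑' i, ∫⁻ x, M x * Φ (h i x / M x) ∂μ := ENNReal.tsum_le_tsum key
      _ = ∫⁻ x, ∑' i, M x * Φ (h i x / M x) ∂μ := by
          refine (lintegral_tsum fun i => ?_).symm
          exact hM.mul (Φ.mono.measurable.comp_aemeasurable ((hh i).div hM))
      _ = ∫⁻ x, M x * ∑' i, Φ (h i x / M x) ∂μ := by simp only [ENNReal.tsum_mul_left]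
      _ ≤ ∫⁻ x, M x * 1 ∂μ := by
          refine lintegral_mono_ae ?_
          filter_upwards [hs'] with x hx
          gcongr
      _ ≤ B * 1 := by simpa using hMB
  exact (ENNReal.mul_le_mul_iff_right hB0 ENNReal.coe_ne_top).mp hsum

/-- Minkowski's integral inequality for the `ℓ^Φ` norm, with constant `2`. -/
theorem luxNorm_count_lintegral_le (Φ : YoungFunction) {ι : Type*} [Countable ι]
    [MeasurableSpace ι] [MeasurableSingletonClass ι] [IsFiniteMeasure μ] {h : ι → α → ℝ≥0∞}
    (hh : ∀ i, AEMeasurable (h i) μ)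
    (hN : AEMeasurable (fun x => luxNorm Φ Measure.count fun i => h i x) μ) :
    luxNorm Φ Measure.count (fun i => ∫⁻ x, h i x ∂μ)
      ≤ 2 * ∫⁻ x, luxNorm Φ Measure.count (fun i => h i x) ∂μ := by
  set N : α → ℝ≥0∞ := fun x => luxNorm Φ Measure.count fun i => h i x with hNdef
  -- The ε puts N + ε strictly above the Luxemburg norm, so that the modular there is at most 1. The
  -- summand 1 keeps the bound positive even when μ = 0.
  have main : ∀ ε : ℝ≥0, 0 < ε →
      luxNorm Φ Measure.count (fun i => ∫⁻ x, h i x ∂μ) ≤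
        2 * ((∫⁻ x, N x ∂μ) + ε * (μ Set.univ + 1)) := by
    intro ε hε
    rcases eq_or_ne (∫⁻ x, N x ∂μ) ∞ with hI | hI
    · rw [hI]; simp
    obtain ⟨B, hBeq⟩ : ∃ B : ℝ≥0, (B : ℝ≥0∞) = (∫⁻ x, N x ∂μ) + ε * (μ Set.univ + 1) := by
      refine ⟨_, ENNReal.coe_toNNReal ?_⟩
      exact ENNReal.add_ne_top.mpr ⟨hI, ENNReal.mul_ne_top ENNReal.coe_ne_top (by simp)⟩
    have hB : 0 < B := by
      rw [← ENNReal.coe_pos, hBeq]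
      exact lt_of_lt_of_le (ENNReal.mul_pos (by exact_mod_cast hε.ne') (by simp)) le_add_self
    rw [← hBeq, show (2 : ℝ≥0∞) * B = ((2 * B : ℝ≥0) : ℝ≥0∞) by push_cast; rfl]
    refine luxNorm_le Φ (by positivity) ?_
    rw [lintegral_count]
    refine tsum_lintegral_div_le_one Φ (M := fun x => N x + ε) hh (hN.add_const _) hB ?_ ?_
    · rw [hBeq, lintegral_add_right _ measurable_const, lintegral_const]
      gcongr
      exact le_self_add
    · refine Eventually.of_forall fun x hx => ?_
      have hx' : N x ≠ ∞ := fun h => hx (by simp [h])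
      have := lintegral_le_one_of_luxNorm_lt Φ (μ := Measure.count) (h := fun i => h i x)
        (ENNReal.lt_add_right hx' (ENNReal.coe_ne_zero.mpr hε.ne'))
      rwa [lintegral_count] at this
  have hlim : Tendsto (fun ε : ℝ≥0 => 2 * ((∫⁻ x, N x ∂μ) + ε * (μ Set.univ + 1))) (𝓝[>] 0)
      (𝓝 (2 * ((∫⁻ x, N x ∂μ) + ((0 : ℝ≥0) : ℝ≥0∞) * (μ Set.univ + 1)))) := by
    refine Tendsto.mono_left ?_ nhdsWithin_le_nhds
    refine ENNReal.Tendsto.const_mul (Tendsto.const_add _ ?_) (Or.inr (by simp))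
    exact ENNReal.Tendsto.mul_const (ENNReal.continuous_coe.tendsto 0) (Or.inr (by simp))
  have := ge_of_tendsto hlim (eventually_mem_nhdsWithin.mono fun ε hε => main ε hε)
  simpa using this

/-- Young's inequality for the convolution of `ℓ^Φ` and `ℓ¹`, with constant `2`. -/
theorem luxNorm_tsum_mul_le (Φ : YoungFunction) {ι : Type*} [Countable ι] [AddCommGroup ι]
    [MeasurableSpace ι] [MeasurableSingletonClass ι] (f g : ι → ℝ≥0∞)
    (hg : ∑' j, g j ≠ ∞) :
    luxNorm Φ Measure.count (fun m => ∑' j, f (m + j) * g j)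
      ≤ 2 * (∑' j, g j) * luxNorm Φ Measure.count f := by
  obtain ⟨G, hG⟩ : ∃ G : ℝ≥0, (G : ℝ≥0∞) = ∑' j, g j := ⟨_, ENNReal.coe_toNNReal hg⟩
  rcases eq_or_ne G 0 with hG0 | hG0
  · have hz : ∀ j, g j = 0 := by
      rw [hG0, ENNReal.coe_zero] at hG
      exact ENNReal.tsum_eq_zero.mp hG.symm
    simp [hz, luxNorm_zero]
  rw [← hG, show (2 : ℝ≥0∞) * G = ((2 * G : ℝ≥0) : ℝ≥0∞) by push_cast; rfl]
  refine le_mul_luxNorm (by positivity) fun b hb hi => ?_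
  rw [← ENNReal.coe_mul]
  refine luxNorm_le Φ (by positivity) ?_
  rw [lintegral_count] at hi ⊢
  rw [mul_assoc]
  -- Both sums become integrals and only the outer one is turned back, so that the convolution is an
  -- integral over j.
  simp only [← lintegral_count (α := ι)]
  rw [lintegral_count]
  have hm : ∀ u : ι → ℝ≥0∞, AEMeasurable u Measure.count := fun u =>
    (measurable_of_countable u).aemeasurable
  -- With M(j) = g(j) b the quotient is a translate of f / b, whose modular does not depend on j.
  refine tsum_lintegral_div_le_one Φ (M := fun j => g j * b) (fun _ => hm _) (hm _)
    (by positivity) ?_ ?_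
  · rw [lintegral_count, ENNReal.tsum_mul_right, ← hG, ENNReal.coe_mul]
  · refine Eventually.of_forall fun j hj => ?_
    have hb0 : (b : ℝ≥0∞) ≠ 0 := by exact_mod_cast hb.ne'
    rcases eq_or_ne (g j) 0 with h0 | h0
    · simp [h0, Φ.map_zero']
    have hgj : g j ≠ ∞ := ne_top_of_le_ne_top hg (ENNReal.le_tsum j)
    calc ∑' m, Φ (f (m + j) * g j / (g j * b)) = ∑' m, Φ (f (m + j) / b) := by
          refine tsum_congr fun m => ?_
          rw [mul_comm, ENNReal.mul_div_mul_left _ _ h0 hgj]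
      _ = ∑' m, Φ (f m / b) := (Equiv.addRight j).tsum_eq fun m => Φ (f m / b)
      _ ≤ 1 := hi

end

/-! ### Seminorms, ℓ¹ norm and unit sequences in 𝒮(ℤⁿ) -/

/-- The sum over `κ^ι` of a product of functions of one coordinate each. -/
theorem tsum_pi_prod_le {ι κ : Type*} [Fintype ι] (a : κ → ℝ≥0∞) :
    ∑' k : ι → κ, ∏ i, a (k i) ≤ (∑' l, a l) ^ Fintype.card ι := by
  classical
  rw [ENNReal.tsum_eq_iSup_sum]
  refine iSup_le fun s => ?_
  -- All coordinates of points of s: s lies in the box t^ι, over which the sum factorizes.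
  set t : Finset κ := s.biUnion fun k => Finset.univ.image k
  have hst : s ⊆ Fintype.piFinset fun _ : ι => t := by
    intro k hk
    rw [Fintype.mem_piFinset]
    intro i
    exact Finset.mem_biUnion.mpr ⟨k, hk, Finset.mem_image_of_mem _ (Finset.mem_univ i)⟩
  calc ∑ k ∈ s, ∏ i, a (k i) ≤ ∑ k ∈ Fintype.piFinset fun _ : ι => t, ∏ i, a (k i) :=
        Finset.sum_le_sum_of_subset hst
    _ = ∏ _i : ι, ∑ l ∈ t, a l := (Finset.prod_univ_sum _ _).symm
    _ ≤ ∏ _i : ι, ∑' l, a l := Finset.prod_le_prod' fun _ _ => ENNReal.sum_le_tsum t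
    _ = (∑' l, a l) ^ Fintype.card ι := by rw [Finset.prod_const, Finset.card_univ]

theorem summable_one_add_norm_int_inv_sq : Summable fun l : ℤ => ((1 + ‖l‖) ^ 2)⁻¹ := by
  have h : Summable fun l : ℕ => ((1 + ‖(l : ℤ)‖) ^ 2)⁻¹ := by
    have := (summable_nat_add_iff 1).mpr (Real.summable_nat_pow_inv.mpr one_lt_two)
    refine this.congr fun l => ?_
    rw [Int.norm_natCast, add_comm]
    push_cast; rfl
  refine Summable.of_nat_of_neg h ?_
  simpa only [norm_neg] using h

namespace SchwartzZ

variable {n : ℕ}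

theorem withSeminorms : WithSeminorms (show SeminormFamily ℂ (SchwartzZ n) ℕ from seminorm n) :=
  ⟨rfl⟩

theorem le_seminorm (j : ℕ) (g : SchwartzZ n) (k : Fin n → ℤ) :
    (1 + ‖k‖) ^ j * ‖g k‖ ≤ seminorm n j g := by
  obtain ⟨C, hC⟩ := g.2 j
  exact le_ciSup (f := fun k : Fin n → ℤ => (1 + ‖k‖) ^ j * ‖g k‖)
    ⟨C, by rintro _ ⟨k, rfl⟩; exact hC k⟩ k

theorem seminorm_le {j : ℕ} {g : SchwartzZ n} {C : ℝ} (h : ∀ k, (1 + ‖k‖) ^ j * ‖g k‖ ≤ C) :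
    seminorm n j g ≤ C :=
  ciSup_le h

/-- For the maximum norm, (1 + ‖k‖)^(2n) dominates ∏ (1 + |k i|)², so the weights factor into n
convergent one-dimensional series. -/
theorem exists_l1Norm_le (n : ℕ) :
    ∃ C : ℝ≥0, ∀ g : SchwartzZ n, g.l1Norm ≤ C * ENNReal.ofReal (seminorm n (2 * n) g) := by
  set S : ℝ≥0∞ := ∑' l : ℤ, ENNReal.ofReal ((1 + ‖l‖) ^ 2)⁻¹ with hS
  have hSfin : S ≠ ∞ := summable_one_add_norm_int_inv_sq.tsum_ofReal_ne_top
  refine ⟨(S ^ n).toNNReal, fun g => ?_⟩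
  rw [ENNReal.coe_toNNReal (ENNReal.pow_ne_top hSfin)]
  have hk : ∀ k : Fin n → ℤ, ‖g k‖ₑ ≤ (∏ i, ENNReal.ofReal ((1 + ‖k i‖) ^ 2)⁻¹) *
      ENNReal.ofReal (seminorm n (2 * n) g) := by
    intro k
    rw [← ENNReal.ofReal_prod_of_nonneg fun i _ => by positivity,
      ← ENNReal.ofReal_mul (Finset.prod_nonneg fun i _ => by positivity), ← ofReal_norm]
    refine ENNReal.ofReal_le_ofReal ?_
    rw [Finset.prod_inv_distrib, ← div_eq_inv_mul,
      le_div_iff₀ (Finset.prod_pos fun i _ => by positivity), mul_comm]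
    refine le_trans ?_ (le_seminorm (2 * n) g k)
    gcongr
    calc ∏ i, (1 + ‖k i‖) ^ 2 ≤ ∏ _i : Fin n, (1 + ‖k‖) ^ 2 := by
          refine Finset.prod_le_prod (fun i _ => by positivity) fun i _ => ?_
          gcongr
          exact norm_le_pi_norm k i
      _ = (1 + ‖k‖) ^ (2 * n) := by simp [pow_mul]
  calc g.l1Norm ≤ ∑' k : Fin n → ℤ, (∏ i, ENNReal.ofReal ((1 + ‖k i‖) ^ 2)⁻¹) *
      ENNReal.ofReal (seminorm n (2 * n) g) := ENNReal.tsum_le_tsum hk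
    _ = (∑' k : Fin n → ℤ, ∏ i, ENNReal.ofReal ((1 + ‖k i‖) ^ 2)⁻¹) *
      ENNReal.ofReal (seminorm n (2 * n) g) := ENNReal.tsum_mul_right
    _ ≤ S ^ n * ENNReal.ofReal (seminorm n (2 * n) g) := by
        gcongr
        simpa using tsum_pi_prod_le (ι := Fin n)
          (fun l : ℤ => ENNReal.ofReal ((1 + ‖l‖) ^ 2)⁻¹)

theorem l1Norm_ne_top (g : SchwartzZ n) : g.l1Norm ≠ ∞ := by
  obtain ⟨C, hC⟩ := exists_l1Norm_le n
  exact ne_top_of_le_ne_top (ENNReal.mul_ne_top ENNReal.coe_ne_top ENNReal.ofReal_ne_top) (hC g)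

theorem add_apply (g h : SchwartzZ n) (k : Fin n → ℤ) : (g + h) k = g k + h k := rfl

theorem smul_apply (c : ℂ) (g : SchwartzZ n) (k : Fin n → ℤ) : (c • g) k = c * g k := rfl

theorem sub_apply (g h : SchwartzZ n) (k : Fin n → ℤ) : (g - h) k = g k - h k := rfl

theorem sum_apply {ι : Type*} (s : Finset ι) (g : ι → SchwartzZ n) (k : Fin n → ℤ) :
    (∑ i ∈ s, g i) k = ∑ i ∈ s, g i k := by
  classical
  induction s using Finset.induction_on with
  | empty => rfl
  | insert i s hi ih => rw [Finset.sum_insert hi, Finset.sum_insert hi, add_apply, ih]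

theorem delta_apply (k l : Fin n → ℤ) : delta k l = if l = k then 1 else 0 := by
  change (Pi.single k 1 : (Fin n → ℤ) → ℂ) l = _
  rw [Pi.single_apply]

/-- Every rapidly decreasing sequence is the sum of its terms. -/
theorem hasSum_smul_delta (g : SchwartzZ n) : HasSum (fun k => g k • delta k) g := by
  classical
  change Tendsto (fun s : Finset (Fin n → ℤ) => ∑ k ∈ s, g k • delta k) _ (𝓝 g)
  rw [withSeminorms.tendsto_nhds]
  intro j ε hε
  set C := seminorm n (j + 1) g
  -- The next seminorm gives one more power of 1 + ‖k‖, so the large terms lie in a ball, which is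
  -- finite. Using ε / 2 keeps the final inequality strict after taking the supremum.
  have hfin : Set.Finite {k : Fin n → ℤ | ε / 2 ≤ (1 + ‖k‖) ^ j * ‖g k‖} := by
    refine (isCompact_closedBall (0 : Fin n → ℤ) (C / (ε / 2))).finite_of_discrete.subset ?_
    intro k hk
    rw [Set.mem_ofPred_eq] at hk
    rw [mem_closedBall_zero_iff, le_div_iff₀ (by positivity)]
    calc ‖k‖ * (ε / 2) ≤ (1 + ‖k‖) * ((1 + ‖k‖) ^ j * ‖g k‖) := by
          gcongr; linarith [norm_nonneg k]
      _ = (1 + ‖k‖) ^ (j + 1) * ‖g k‖ := by ring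
      _ ≤ C := le_seminorm (j + 1) g k
  filter_upwards [eventually_ge_atTop hfin.toFinset] with s hs
  refine lt_of_le_of_lt (seminorm_le (C := ε / 2) fun k => ?_) (half_lt_self hε)
  have hval : (∑ l ∈ s, g l • delta l - g) k = if k ∈ s then 0 else - g k := by
    rw [sub_apply, sum_apply]
    simp only [smul_apply, delta_apply, mul_ite, mul_one, mul_zero, Finset.sum_ite_eq]
    split_ifs <;> simp
  rw [hval]
  split_ifs with hks
  · simp; positivity
  · rw [norm_neg]
    by_contra hcon
    exact hks (hs (hfin.mem_toFinset.mpr (not_le.mp hcon).le))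

theorem conjS_conjS (g : SchwartzZ n) : g.conjS.conjS = g :=
  Subtype.ext (funext fun k => Complex.conj_conj (g k))

theorem conjS_apply (g : SchwartzZ n) (k : Fin n → ℤ) : g.conjS k = conj (g k) := rfl

theorem conjS_delta (k : Fin n → ℤ) : (delta k).conjS = delta k := by
  refine Subtype.ext (funext fun l => ?_)
  change conj (delta k l) = delta k l
  rw [delta_apply]
  split_ifs <;> simp

theorem l1Norm_conjS (g : SchwartzZ n) : g.conjS.l1Norm = g.l1Norm := by
  refine tsum_congr fun k => ?_
  rw [conjS_apply, ← ofReal_norm, RCLike.norm_conj, ofReal_norm]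

/-- A linear functional which is bounded for the `ℓ¹` norm is continuous. -/
theorem continuous_of_le_l1Norm (u : SchwartzZ n →ₗ[ℂ] ℂ) {A : ℝ≥0∞} (hA : A ≠ ∞)
    (hu : ∀ g, ‖u g‖ₑ ≤ A * g.l1Norm) : Continuous u := by
  obtain ⟨C, hC⟩ := exists_l1Norm_le n
  refine WithSeminorms.continuous_normedSpace_rng ℂ withSeminorms u ⟨{2 * n}, A.toNNReal * C, ?_⟩
  intro g
  rw [Finset.sup_singleton]
  change ‖u g‖ ≤ ((A.toNNReal * C : ℝ≥0) : ℝ) * seminorm n (2 * n) g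
  have h := (hu g).trans (mul_le_mul_right (hC g) A)
  rw [← ofReal_norm, ← ENNReal.coe_toNNReal hA, ← mul_assoc, ← ENNReal.coe_mul,
    ← ENNReal.ofReal_coe_nnreal, ← ENNReal.ofReal_mul (by positivity)] at h
  exact (ENNReal.ofReal_le_ofReal_iff
    (mul_nonneg (NNReal.coe_nonneg _) (apply_nonneg _ _))).mp h

end SchwartzZ

/-! ### Haar measure and characters on the torus -/

theorem volume_unitAddCircle : (volume : Measure UnitAddCircle) = AddCircle.haarAddCircle := by
  rw [AddCircle.volume_eq_smul_haarAddCircle]; simp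

theorem volume_unitAddTorus (d : Type*) [Fintype d] :
    (volume : Measure (UnitAddTorus d)) = Measure.pi fun _ => AddCircle.haarAddCircle := by
  rw [← volume_unitAddCircle]; rfl

instance (d : Type*) [Fintype d] : IsProbabilityMeasure (volume : Measure (UnitAddTorus d)) := by
  rw [volume_unitAddTorus]; infer_instance

theorem norm_mFourier_apply {d : Type*} [Fintype d] (k : d → ℤ) (w : UnitAddTorus d) :
    ‖UnitAddTorus.mFourier k w‖ = 1 := by
  simp only [UnitAddTorus.mFourier, ContinuousMap.coe_mk, norm_prod, fourier_apply,
    Circle.norm_coe, Finset.prod_const_one]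

theorem integral_mFourier_mul_conj {d : Type*} [Fintype d] (k l : d → ℤ) :
    ∫ w, UnitAddTorus.mFourier l w * conj (UnitAddTorus.mFourier k w)
      = if k = l then 1 else 0 := by
  classical
  have h := orthonormal_iff_ite.mp (UnitAddTorus.orthonormal_mFourier (d := d)) k l
  rw [ContinuousMap.inner_toLp] at h
  rw [volume_unitAddTorus]
  exact h

instance (n : ℕ) : SFinite (phaseMeasure n) := by unfold phaseMeasure; infer_instance

theorem lintegral_phaseMeasure {n : ℕ} {F : Phase n → ℝ≥0∞} (hF : AEMeasurable F (phaseMeasure n)) :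
    ∫⁻ p, F p ∂(phaseMeasure n) = ∑' m, ∫⁻ w, F (m, w) := by
  unfold phaseMeasure at hF ⊢
  rw [lintegral_prod _ hF, lintegral_count]

/-! ### The short-time Fourier transform of sequences -/

namespace SchwartzZ

variable {n : ℕ}

theorem tfShift_apply (p : Phase n) (g : SchwartzZ n) (k : Fin n → ℤ) :
    g.tfShift p k = UnitAddTorus.mFourier k p.2 * g (k - p.1) := rfl

theorem norm_tfShift_apply (p : Phase n) (g : SchwartzZ n) (k : Fin n → ℤ) :
    ‖g.tfShift p k‖ = ‖g (k - p.1)‖ := by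
  rw [tfShift_apply, norm_mul, norm_mFourier_apply, one_mul]

/-- The short-time Fourier transform of a sequence. -/
def seqStft (g : SchwartzZ n) (a : (Fin n → ℤ) → ℂ) (p : Phase n) : ℂ :=
  ∑' k, a k * conj (g.tfShift p k)

/-- Characters have modulus 1, so the size of a term does not depend on w. The estimates and the
convergence of the series are therefore uniform in w. -/
theorem norm_seqStft_term (g : SchwartzZ n) (a : (Fin n → ℤ) → ℂ) (p : Phase n)
    (k : Fin n → ℤ) : ‖a k * conj (g.tfShift p k)‖ = ‖a k * g (k - p.1)‖ := by
  rw [norm_mul, norm_mul, RCLike.norm_conj, norm_tfShift_apply]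

theorem enorm_seqStft_le (g : SchwartzZ n) (a : (Fin n → ℤ) → ℂ) (p : Phase n) :
    ‖g.seqStft a p‖ₑ ≤ ∑' k, ‖a k‖ₑ * ‖g (k - p.1)‖ₑ := by
  refine enorm_tsum_le_tsum_enorm.trans (le_of_eq (tsum_congr fun k => ?_))
  rw [← enorm_mul, ← ofReal_norm, norm_seqStft_term, ofReal_norm]

theorem continuous_seqStft (g : SchwartzZ n) {a : (Fin n → ℤ) → ℂ} {m : Fin n → ℤ}
    (ha : Summable fun k => ‖a k * g (k - m)‖) : Continuous fun w => g.seqStft a (m, w) := by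
  refine continuous_tsum (fun k => ?_) ha fun k w => (norm_seqStft_term g a (m, w) k).le
  simp only [tfShift_apply]
  exact continuous_const.mul (Complex.continuous_conj.comp
    ((UnitAddTorus.mFourier k).continuous.mul continuous_const))

theorem measurable_seqStft (g : SchwartzZ n) {a : (Fin n → ℤ) → ℂ}
    (ha : ∀ m, Summable fun k => ‖a k * g (k - m)‖) : Measurable (g.seqStft a) :=
  measurable_from_prod_countable_right fun m => (continuous_seqStft g (ha m)).measurable

/-- The Fourier coefficients of the short-time Fourier transform of a sequence. -/
theorem integral_mFourier_mul_seqStft (g : SchwartzZ n) {a : (Fin n → ℤ) → ℂ} {m : Fin n → ℤ}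
    (ha : Summable fun k => ‖a k * g (k - m)‖) (l : Fin n → ℤ) :
    ∫ w, UnitAddTorus.mFourier l w * g.seqStft a (m, w) = a l * conj (g (l - m)) := by
  classical
  have hnorm : ∀ k w, ‖UnitAddTorus.mFourier l w * (a k * conj (g.tfShift (m, w) k))‖
      = ‖a k * g (k - m)‖ := fun k w => by
    rw [norm_mul, norm_mFourier_apply, one_mul, norm_seqStft_term]
  have hcont : ∀ k, Continuous fun w : UnitAddTorus (Fin n) =>
      UnitAddTorus.mFourier l w * (a k * conj (g.tfShift (m, w) k)) := fun k => by
    simp only [tfShift_apply]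
    exact (UnitAddTorus.mFourier l).continuous.mul (continuous_const.mul
      (Complex.continuous_conj.comp
        ((UnitAddTorus.mFourier k).continuous.mul continuous_const)))
  have hint : ∀ k, Integrable (fun w : UnitAddTorus (Fin n) =>
      UnitAddTorus.mFourier l w * (a k * conj (g.tfShift (m, w) k))) := fun k =>
    Integrable.of_bound (hcont k).aestronglyMeasurable _
      (Eventually.of_forall fun w => (hnorm k w).le)
  have h := hasSum_integral_of_summable_integral_norm hint
    (by simpa only [hnorm, integral_const, probReal_univ, one_smul] using ha)
  have hterm : ∀ k, ∫ w, UnitAddTorus.mFourier l w * (a k * conj (g.tfShift (m, w) k))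
      = if k = l then a l * conj (g (l - m)) else 0 := by
    intro k
    have e : ∀ w, UnitAddTorus.mFourier l w * (a k * conj (g.tfShift (m, w) k))
        = (a k * conj (g (k - m))) *
          (UnitAddTorus.mFourier l w * conj (UnitAddTorus.mFourier k w)) := fun w => by
      rw [tfShift_apply, map_mul]; ring
    simp only [e]
    rw [integral_const_mul, integral_mFourier_mul_conj]
    split_ifs with hkl
    · rw [hkl, mul_one]
    · rw [mul_zero]
  simp only [hterm, tsum_mul_left] at h
  exact h.unique (hasSum_ite_eq l _)

theorem stft_eq_seqStft (g h : SchwartzZ n) : SchwartzZ.stft g h = g.seqStft h := rfl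

theorem summable_mul (g h : SchwartzZ n) (m : Fin n → ℤ) :
    Summable fun k => ‖h k * g (k - m)‖ := by
  rw [← tsum_enorm_ne_top_iff_summable_norm]
  refine ne_top_of_le_ne_top (ENNReal.mul_ne_top h.l1Norm_ne_top g.l1Norm_ne_top) ?_
  calc ∑' k, ‖h k * g (k - m)‖ₑ ≤ ∑' k, ‖h k‖ₑ * g.l1Norm := by
        refine ENNReal.tsum_le_tsum fun k => ?_
        rw [enorm_mul]
        gcongr
        exact ENNReal.le_tsum (f := fun k => ‖g k‖ₑ) (k - m)
    _ = h.l1Norm * g.l1Norm := ENNReal.tsum_mul_right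

theorem summable_seqStft (g h : SchwartzZ n) (p : Phase n) :
    Summable fun k => h k * conj (g.tfShift p k) :=
  Summable.of_norm (by simpa only [norm_seqStft_term] using summable_mul g h p.1)

theorem stft_add (g h h' : SchwartzZ n) (p : Phase n) :
    SchwartzZ.stft g (h + h') p = SchwartzZ.stft g h p + SchwartzZ.stft g h' p := by
  simp only [SchwartzZ.stft, add_apply, add_mul]
  exact (summable_seqStft g h p).tsum_add (summable_seqStft g h' p)

theorem stft_smul (g h : SchwartzZ n) (c : ℂ) (p : Phase n) :
    SchwartzZ.stft g (c • h) p = c * SchwartzZ.stft g h p := by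
  simp only [SchwartzZ.stft, smul_apply, mul_assoc, tsum_mul_left]

theorem stft_delta (g : SchwartzZ n) (k : Fin n → ℤ) (p : Phase n) :
    SchwartzZ.stft g (delta k) p = conj (g.tfShift p k) := by
  classical
  simp only [SchwartzZ.stft, delta_apply, ite_mul, one_mul, zero_mul]
  exact tsum_ite_eq k _

theorem tsum_shift_eq (a : (Fin n → ℤ) → ℝ≥0∞) (g : SchwartzZ n) (m : Fin n → ℤ) :
    ∑' k, a k * ‖g (k - m)‖ₑ = ∑' j, a (m + j) * ‖g j‖ₑ := by
  rw [← (Equiv.addLeft m).tsum_eq]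
  simp

theorem tsum_enorm_sub (g : SchwartzZ n) (k : Fin n → ℤ) :
    ∑' m, ‖g (k - m)‖ₑ = g.l1Norm :=
  (Equiv.subLeft k).tsum_eq fun m => ‖g m‖ₑ

theorem tsum_enorm_neg (g : SchwartzZ n) : ∑' m, ‖g (-m)‖ₑ = g.l1Norm :=
  (Equiv.neg _).tsum_eq fun m => ‖g m‖ₑ

end SchwartzZ

/-! ### Tempered distributions as sequences; M^{Φ₁,Φ₂} as ℓ^{Φ₁} -/

namespace TemperedZ

variable {n : ℕ}

/-- The `ℓ^Φ` norm of a tempered distribution, as a function on `ℤⁿ`. -/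
def seqNorm (Φ : YoungFunction) (f : TemperedZ n) : ℝ≥0∞ :=
  luxNorm Φ Measure.count fun k => ‖f (SchwartzZ.delta k)‖ₑ

theorem hasSum_apply (f : TemperedZ n) (h : SchwartzZ n) :
    HasSum (fun k => h k * f (SchwartzZ.delta k)) (f h) := by
  simpa only [map_smul, smul_eq_mul, Function.comp_def] using
    (SchwartzZ.hasSum_smul_delta h).map f f.continuous

theorem stft_eq_seqStft (g : SchwartzZ n) (f : TemperedZ n) :
    stft g f = g.seqStft fun k => f (SchwartzZ.delta k) := by
  ext p
  refine (f.hasSum_apply (g.tfShift p).conjS).tsum_eq.symm.trans (tsum_congr fun k => ?_)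
  rw [SchwartzZ.conjS_apply, mul_comm]

theorem summable_mul (g : SchwartzZ n) (f : TemperedZ n) (m : Fin n → ℤ) :
    Summable fun k => ‖f (SchwartzZ.delta k) * g (k - m)‖ := by
  -- Unconditional convergence in ℂ is absolute. The norms of the terms do not involve w, so w = 0
  -- suffices.
  have h := (f.hasSum_apply (g.tfShift (m, 0)).conjS).summable.norm
  refine h.congr fun k => ?_
  rw [SchwartzZ.conjS_apply, mul_comm]
  exact SchwartzZ.norm_seqStft_term g (fun k => f (SchwartzZ.delta k)) (m, 0) k

theorem measurable_stft (g : SchwartzZ n) (f : TemperedZ n) : Measurable (stft g f) := by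
  rw [stft_eq_seqStft]
  exact g.measurable_seqStft (summable_mul g f)

theorem enorm_stft_le (g : SchwartzZ n) (f : TemperedZ n) (p : Phase n) :
    ‖stft g f p‖ₑ ≤ ∑' j, ‖f (SchwartzZ.delta (p.1 + j))‖ₑ * ‖g j‖ₑ := by
  rw [stft_eq_seqStft, ← SchwartzZ.tsum_shift_eq fun k => ‖f (SchwartzZ.delta k)‖ₑ]
  exact g.enorm_seqStft_le _ p

theorem pairing_delta (u : TemperedZ n) (k : Fin n → ℤ) :
    u.pairing (SchwartzZ.delta k) = u (SchwartzZ.delta k) := by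
  rw [pairing, SchwartzZ.conjS_delta]

theorem ext_pairing {u v : TemperedZ n} (h : ∀ φ, u.pairing φ = v.pairing φ) : u = v := by
  ext φ
  have := h φ.conjS
  rwa [pairing, pairing, SchwartzZ.conjS_conjS] at this

theorem luxNorm_stft_le (Φ : YoungFunction) (g : SchwartzZ n) (f : TemperedZ n)
    (w : UnitAddTorus (Fin n)) :
    luxNorm Φ Measure.count (fun m => ‖stft g f (m, w)‖ₑ) ≤ 2 * g.l1Norm * seqNorm Φ f :=
  (luxNorm_mono Φ fun m => enorm_stft_le g f (m, w)).trans
    (luxNorm_tsum_mul_le Φ (fun k => ‖f (SchwartzZ.delta k)‖ₑ) (fun k => ‖g k‖ₑ) g.l1Norm_ne_top)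

theorem exists_modulationNorm_le (Φ₁ Φ₂ : YoungFunction) (hΦ₂ : Continuous Φ₂.toFun)
    (g : SchwartzZ n) :
    ∃ K : ℝ≥0, ∀ f : TemperedZ n, modulationNorm Φ₁ Φ₂ g f ≤ K * seqNorm Φ₁ f := by
  obtain ⟨K, hK⟩ := exists_luxNorm_const_le Φ₂ hΦ₂
  refine ⟨K * (2 * g.l1Norm.toNNReal), fun f => ?_⟩
  have h1 : modulationNorm Φ₁ Φ₂ g f
      ≤ luxNorm Φ₂ volume fun _ : UnitAddTorus (Fin n) => 2 * g.l1Norm * seqNorm Φ₁ f :=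
    luxNorm_mono Φ₂ fun w => luxNorm_stft_le Φ₁ g f w
  refine (h1.trans (hK volume _)).trans (le_of_eq ?_)
  rw [ENNReal.coe_mul, ENNReal.coe_mul, ENNReal.coe_toNNReal g.l1Norm_ne_top, ENNReal.coe_ofNat]
  ring

end TemperedZ

/-- The sequence of the `L¹(𝕋ⁿ)` norms of the slices of a function is bounded in `ℓ^{Φ₁}` by its mixed
norm. -/
theorem exists_luxNorm_lintegral_le_mixedNorm (n : ℕ) (Φ₁ Φ₂ : YoungFunction) :
    ∃ K : ℝ≥0, ∀ F : Phase n → ℂ, AEStronglyMeasurable F (phaseMeasure n) →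
      luxNorm Φ₁ Measure.count (fun m => ∫⁻ w, ‖F (m, w)‖ₑ) ≤ K * mixedNorm Φ₁ Φ₂ F := by
  obtain ⟨K, hK⟩ := exists_lintegral_le_mul_luxNorm Φ₂
  refine ⟨2 * K, fun F hF => ?_⟩
  refine (luxNorm_count_lintegral_le Φ₁ (aemeasurable_slice hF)
    (aemeasurable_innerNorm Φ₁ hF)).trans ?_
  rw [ENNReal.coe_mul, mul_assoc]
  exact mul_le_mul_right (hK volume _) _

theorem luxNorm_count_translate (Φ : YoungFunction) {ι : Type*} [AddGroup ι] [MeasurableSpace ι]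
    [MeasurableSingletonClass ι] (h : ι → ℝ≥0∞) (j : ι) :
    luxNorm Φ Measure.count (fun m => h (m + j)) = luxNorm Φ Measure.count h := by
  unfold luxNorm
  simp only [lintegral_count]
  congr! 5 with b hb
  exact (Equiv.addRight j).tsum_eq fun m => Φ (h m / b)

/-- At a fixed j with g(j) ≠ 0, the (m + j)-th Fourier coefficient of V_g f(m, ·) recovers f(m + j)
up to the factor conj g(j). The L¹ norm of the slice dominates it, and the translation by j leaves
the ℓ^{Φ₁} norm unchanged. -/
theorem TemperedZ.exists_seqNorm_le {n : ℕ} (Φ₁ Φ₂ : YoungFunction) {g : SchwartzZ n}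
    (hg : g ≠ 0) :
    ∃ K : ℝ≥0, ∀ f : TemperedZ n, seqNorm Φ₁ f ≤ K * modulationNorm Φ₁ Φ₂ g f := by
  obtain ⟨j, hj⟩ : ∃ j, g j ≠ 0 := by
    by_contra! h
    exact hg (Subtype.ext (funext h))
  obtain ⟨K, hK⟩ := exists_luxNorm_lintegral_le_mixedNorm n Φ₁ Φ₂
  refine ⟨‖g j‖₊⁻¹ * K, fun f => ?_⟩
  have hγ : ‖g j‖₊ ≠ 0 := by simpa using hj
  have key : ∀ m, ‖f (SchwartzZ.delta (m + j))‖ₑ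
      ≤ ((‖g j‖₊⁻¹ : ℝ≥0) : ℝ≥0∞) * ∫⁻ w, ‖stft g f (m, w)‖ₑ := by
    intro m
    have h := SchwartzZ.integral_mFourier_mul_seqStft g (summable_mul g f m) (m + j)
    rw [add_sub_cancel_left, ← stft_eq_seqStft] at h
    rw [ENNReal.coe_inv hγ, ← ENNReal.div_eq_inv_mul, ENNReal.le_div_iff_mul_le
      (Or.inl (by exact_mod_cast hγ)) (Or.inl ENNReal.coe_ne_top)]
    calc ‖f (SchwartzZ.delta (m + j))‖ₑ * (‖g j‖₊ : ℝ≥0∞)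
        = ‖f (SchwartzZ.delta (m + j)) * conj (g j)‖ₑ := by
          rw [enorm_mul]
          congr 1
          change _ = ((‖conj (g j)‖₊ : ℝ≥0) : ℝ≥0∞)
          rw [RCLike.nnnorm_conj]
      _ ≤ ∫⁻ w, ‖UnitAddTorus.mFourier (m + j) w * stft g f (m, w)‖ₑ := by
          rw [← h]; exact enorm_integral_le_lintegral_enorm _
      _ = ∫⁻ w, ‖stft g f (m, w)‖ₑ := by
          refine lintegral_congr fun w => ?_
          rw [← ofReal_norm, norm_mul, norm_mFourier_apply, one_mul, ofReal_norm]
  calc seqNorm Φ₁ f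
      = luxNorm Φ₁ Measure.count fun m => ‖f (SchwartzZ.delta (m + j))‖ₑ :=
        (luxNorm_count_translate Φ₁ (fun k => ‖f (SchwartzZ.delta k)‖ₑ) j).symm
    _ ≤ ((‖g j‖₊⁻¹ : ℝ≥0) : ℝ≥0∞) *
          luxNorm Φ₁ Measure.count fun m => ∫⁻ w, ‖stft g f (m, w)‖ₑ :=
        (luxNorm_mono Φ₁ key).trans (luxNorm_const_mul_le Φ₁ _ _)
    _ ≤ ((‖g j‖₊⁻¹ : ℝ≥0) : ℝ≥0∞) * (K * modulationNorm Φ₁ Φ₂ g f) := by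
        gcongr
        exact hK _ (measurable_stft g f).aestronglyMeasurable
    _ = ((‖g j‖₊⁻¹ * K : ℝ≥0) : ℝ≥0∞) * modulationNorm Φ₁ Φ₂ g f := by
        rw [ENNReal.coe_mul, mul_assoc]

/-! ### Synthesis from functions on phase space -/

theorem lintegral_mul_stft_le {n : ℕ} {H : Phase n → ℂ}
    (hH : AEStronglyMeasurable H (phaseMeasure n)) (g h : SchwartzZ n) :
    ∫⁻ p, ‖H p * conj (SchwartzZ.stft g h p)‖ₑ ∂(phaseMeasure n)
      ≤ ∑' m, (∫⁻ w, ‖H (m, w)‖ₑ) * ∑' k, ‖h k‖ₑ * ‖g (k - m)‖ₑ := by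
  have hm : Measurable (SchwartzZ.stft g h) := by
    rw [SchwartzZ.stft_eq_seqStft]
    exact g.measurable_seqStft (SchwartzZ.summable_mul g h)
  have hm' : AEStronglyMeasurable (fun p => H p * conj (SchwartzZ.stft g h p)) (phaseMeasure n) :=
    hH.mul (Complex.continuous_conj.measurable.comp hm).aestronglyMeasurable
  rw [lintegral_phaseMeasure hm'.enorm]
  refine ENNReal.tsum_le_tsum fun m => ?_
  rw [← lintegral_mul_const'' _ (aemeasurable_slice hH m)]
  refine lintegral_mono fun w => ?_
  rw [enorm_mul]
  gcongr
  rw [← ofReal_norm, RCLike.norm_conj, ofReal_norm]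
  exact g.enorm_seqStft_le h (m, w)

/-- The synthesis of a tempered distribution from a function on phase space, all of whose slices
have `L¹(𝕋ⁿ)` norm at most `A`. -/
theorem exists_synthesis {n : ℕ} {H : Phase n → ℂ}
    (hH : AEStronglyMeasurable H (phaseMeasure n)) {A : ℝ≥0∞} (hA : A ≠ ∞)
    (hHA : ∀ m, ∫⁻ w, ‖H (m, w)‖ₑ ≤ A) (g : SchwartzZ n) :
    ∃ u : TemperedZ n,
      (∀ h : SchwartzZ n,
        Integrable (fun p => H p * conj (SchwartzZ.stft g h p)) (phaseMeasure n) ∧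
        u.pairing h = ∫ p, H p * conj (SchwartzZ.stft g h p) ∂(phaseMeasure n)) ∧
      ∀ k, ‖u (SchwartzZ.delta k)‖ₑ ≤ ∑' j, (∫⁻ w, ‖H (k + j, w)‖ₑ) * ‖g (-j)‖ₑ := by
  have hbound : ∀ h : SchwartzZ n,
      ∫⁻ p, ‖H p * conj (SchwartzZ.stft g h p)‖ₑ ∂(phaseMeasure n)
        ≤ A * g.l1Norm * h.l1Norm := by
    intro h
    calc ∫⁻ p, ‖H p * conj (SchwartzZ.stft g h p)‖ₑ ∂(phaseMeasure n)
        ≤ ∑' m, A * ∑' k, ‖h k‖ₑ * ‖g (k - m)‖ₑ :=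
          (lintegral_mul_stft_le hH g h).trans
            (ENNReal.tsum_le_tsum fun m => by gcongr; exact hHA m)
      _ = A * ∑' k, ‖h k‖ₑ * g.l1Norm := by
          rw [ENNReal.tsum_mul_left, ENNReal.tsum_comm]
          simp only [ENNReal.tsum_mul_left, SchwartzZ.tsum_enorm_sub]
      _ = A * g.l1Norm * h.l1Norm := by
          rw [ENNReal.tsum_mul_right, mul_assoc, mul_comm g.l1Norm]; rfl
  have hint : ∀ h : SchwartzZ n,
      Integrable (fun p => H p * conj (SchwartzZ.stft g h p)) (phaseMeasure n) := by
    intro h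
    have hm : Measurable (SchwartzZ.stft g h) := by
      rw [SchwartzZ.stft_eq_seqStft]
      exact g.measurable_seqStft (SchwartzZ.summable_mul g h)
    refine ⟨hH.mul (Complex.continuous_conj.measurable.comp hm).aestronglyMeasurable,
      (hbound h).trans_lt ?_⟩
    exact (ENNReal.mul_ne_top (ENNReal.mul_ne_top hA g.l1Norm_ne_top) h.l1Norm_ne_top).lt_top
  have conj_add : ∀ h h' : SchwartzZ n, (h + h').conjS = h.conjS + h'.conjS := fun h h' =>
    Subtype.ext (funext fun k => map_add (starRingEnd ℂ) (h k) (h' k))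
  have conj_smul : ∀ (c : ℂ) (h : SchwartzZ n), (c • h).conjS = conj c • h.conjS := fun c h =>
    Subtype.ext (funext fun k => map_mul (starRingEnd ℂ) c (h k))
  -- The pairing conjugates its second argument. Conjugating the test function here compensates for
  -- that and makes the functional linear.
  let T : SchwartzZ n →ₗ[ℂ] ℂ :=
    { toFun := fun φ => ∫ p, H p * conj (SchwartzZ.stft g φ.conjS p) ∂(phaseMeasure n)
      map_add' := fun φ φ' => by
        rw [← integral_add (hint _) (hint _)]
        refine integral_congr_ae (Eventually.of_forall fun p => ?_)
        simp only [conj_add, SchwartzZ.stft_add, map_add, mul_add]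
      map_smul' := fun c φ => by
        rw [RingHom.id_apply, smul_eq_mul, ← integral_const_mul]
        refine integral_congr_ae (Eventually.of_forall fun p => ?_)
        simp only [conj_smul, SchwartzZ.stft_smul, map_mul, Complex.conj_conj]
        ring }
  have hT : Continuous T := by
    refine SchwartzZ.continuous_of_le_l1Norm T (ENNReal.mul_ne_top hA g.l1Norm_ne_top) fun φ => ?_
    refine (enorm_integral_le_lintegral_enorm _).trans ((hbound φ.conjS).trans (le_of_eq ?_))
    rw [SchwartzZ.l1Norm_conjS]
  have hpair : ∀ h : SchwartzZ n, TemperedZ.pairing ⟨T, hT⟩ h =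
      ∫ p, H p * conj (SchwartzZ.stft g h p) ∂(phaseMeasure n) := fun h => by
    change ∫ p, H p * conj (SchwartzZ.stft g h.conjS.conjS p) ∂(phaseMeasure n) = _
    rw [SchwartzZ.conjS_conjS]
  refine ⟨⟨T, hT⟩, fun h => ⟨hint h, hpair h⟩, fun k => ?_⟩
  rw [← TemperedZ.pairing_delta, hpair]
  refine (enorm_integral_le_lintegral_enorm _).trans
    ((lintegral_mul_stft_le hH g _).trans (le_of_eq ?_))
  classical
  have e : ∀ m, ∑' l, ‖SchwartzZ.delta k l‖ₑ * ‖g (l - m)‖ₑ = ‖g (k - m)‖ₑ := by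
    intro m
    rw [tsum_eq_single k fun l hl => by rw [SchwartzZ.delta_apply, if_neg hl]; simp]
    rw [SchwartzZ.delta_apply, if_pos rfl]; simp
  simp only [e]
  rw [← (Equiv.addLeft k).tsum_eq]
  simp

/-! ### Localization operators -/

namespace IsLocalizationOf

variable {n : ℕ} {ς : Phase n → ℂ} {g₁ g₂ : SchwartzZ n}

/-- The pointwise formula is the weak one tested on δ_k, because V_{g₂} δ_k is the conjugate of M_w
T_m g₂(k). -/
theorem of_pairing {f u : TemperedZ n}
    (h : ∀ h : SchwartzZ n,
      Integrable (fun p => ς p * stft g₁ f p * conj (SchwartzZ.stft g₂ h p)) (phaseMeasure n) ∧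
      u.pairing h =
        ∫ p, ς p * stft g₁ f p * conj (SchwartzZ.stft g₂ h p) ∂(phaseMeasure n)) :
    IsLocalizationOf ς g₁ g₂ f u := by
  refine ⟨fun k => ?_, h⟩
  have := h (SchwartzZ.delta k)
  simpa only [SchwartzZ.stft_delta, Complex.conj_conj, TemperedZ.pairing_delta] using this

/-- The pairings determine the distribution. Together with `add` and `smul` this makes arbitrarily
chosen images depend linearly on f. -/
theorem unique {f u v : TemperedZ n} (hu : IsLocalizationOf ς g₁ g₂ f u)
    (hv : IsLocalizationOf ς g₁ g₂ f v) : u = v :=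
  TemperedZ.ext_pairing fun φ => by rw [(hu.2 φ).2, (hv.2 φ).2]

theorem add {f f' u u' : TemperedZ n} (hu : IsLocalizationOf ς g₁ g₂ f u)
    (hu' : IsLocalizationOf ς g₁ g₂ f' u') : IsLocalizationOf ς g₁ g₂ (f + f') (u + u') := by
  refine of_pairing fun φ => ?_
  have e : (fun p => ς p * stft g₁ (f + f') p * conj (SchwartzZ.stft g₂ φ p)) =
      fun p => ς p * stft g₁ f p * conj (SchwartzZ.stft g₂ φ p)
        + ς p * stft g₁ f' p * conj (SchwartzZ.stft g₂ φ p) := by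
    ext p
    have h : stft g₁ (f + f') p = stft g₁ f p + stft g₁ f' p := rfl
    rw [h]; ring
  rw [e]
  refine ⟨(hu.2 φ).1.add (hu'.2 φ).1, ?_⟩
  rw [integral_add (hu.2 φ).1 (hu'.2 φ).1, ← (hu.2 φ).2, ← (hu'.2 φ).2]
  rfl

theorem smul {f u : TemperedZ n} (c : ℂ) (hu : IsLocalizationOf ς g₁ g₂ f u) :
    IsLocalizationOf ς g₁ g₂ (c • f) (c • u) := by
  refine of_pairing fun φ => ?_
  have e : (fun p => ς p * stft g₁ (c • f) p * conj (SchwartzZ.stft g₂ φ p)) =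
      fun p => c * (ς p * stft g₁ f p * conj (SchwartzZ.stft g₂ φ p)) := by
    ext p
    have h : stft g₁ (c • f) p = c * stft g₁ f p := rfl
    rw [h]; ring
  rw [e]
  refine ⟨(hu.2 φ).1.const_mul c, ?_⟩
  rw [integral_const_mul, ← (hu.2 φ).2]
  rfl

end IsLocalizationOf

/-- Localization operators with symbols in the mixed Orlicz space are defined on `ℓ^{Φ₁}(ℤⁿ)`, and
map it into itself. -/
theorem exists_isLocalizationOf (n : ℕ) (Φ₁ Φ₂ : YoungFunction) :
    ∃ K : ℝ≥0, ∀ (g₁ g₂ : SchwartzZ n) (ς : Phase n → ℂ), MemMixedOrlicz Φ₁ Φ₂ ς →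
      ∀ f : TemperedZ n, f.seqNorm Φ₁ ≠ ∞ → ∃ u : TemperedZ n, IsLocalizationOf ς g₁ g₂ f u ∧
        u.seqNorm Φ₁ ≤ K * g₁.l1Norm * g₂.l1Norm * mixedNorm Φ₁ Φ₂ ς * f.seqNorm Φ₁ := by
  obtain ⟨κ, hκ⟩ := exists_le_mul_luxNorm_count Φ₁
  obtain ⟨K, hK⟩ := exists_luxNorm_lintegral_le_mixedNorm n Φ₁ Φ₂
  refine ⟨2 * κ * K, fun g₁ g₂ ς hς f hf => ?_⟩
  -- A uniform bound for V_{g₁} f: the ℓ^∞ norm of f, controlled by its ℓ^{Φ₁} norm, times ‖g₁‖₁.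
  obtain ⟨S, hS⟩ : ∃ S : ℝ≥0, (S : ℝ≥0∞) = κ * f.seqNorm Φ₁ * g₁.l1Norm :=
    ⟨_, ENNReal.coe_toNNReal
      (ENNReal.mul_ne_top (ENNReal.mul_ne_top ENNReal.coe_ne_top hf) g₁.l1Norm_ne_top)⟩
  have hV : ∀ p, ‖stft g₁ f p‖ₑ ≤ S := fun p =>
    calc ‖stft g₁ f p‖ₑ ≤ ∑' j, ‖f (SchwartzZ.delta (p.1 + j))‖ₑ * ‖g₁ j‖ₑ :=
          TemperedZ.enorm_stft_le g₁ f p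
      _ ≤ ∑' j, κ * f.seqNorm Φ₁ * ‖g₁ j‖ₑ := by
          refine ENNReal.tsum_le_tsum fun j => ?_
          gcongr
          exact hκ (fun k => ‖f (SchwartzZ.delta k)‖ₑ) _
      _ = S := by rw [ENNReal.tsum_mul_left, hS]; rfl
  set a : (Fin n → ℤ) → ℝ≥0∞ := fun m => ∫⁻ w, ‖ς (m, w)‖ₑ
  have ha : luxNorm Φ₁ Measure.count a ≤ K * mixedNorm Φ₁ Φ₂ ς := hK ς hς.1
  have hfin : K * mixedNorm Φ₁ Φ₂ ς ≠ ∞ := ENNReal.mul_ne_top ENNReal.coe_ne_top hς.2.ne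
  have hH : ∀ m, ∫⁻ w, ‖ς (m, w) * stft g₁ f (m, w)‖ₑ ≤ S * a m := by
    intro m
    rw [← lintegral_const_mul' _ _ ENNReal.coe_ne_top]
    refine lintegral_mono fun w => ?_
    rw [enorm_mul, mul_comm]
    gcongr
    exact hV _
  -- The slices of ς · V_{g₁} f have L¹ norm at most S a(m), and a is bounded because ℓ^{Φ₁} embeds
  -- into ℓ^∞.
  obtain ⟨u, hu, hub⟩ := exists_synthesis (H := fun p => ς p * stft g₁ f p)
    (A := S * (κ * (K * mixedNorm Φ₁ Φ₂ ς)))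
    (hς.1.mul (TemperedZ.measurable_stft g₁ f).aestronglyMeasurable)
    (ENNReal.mul_ne_top ENNReal.coe_ne_top (ENNReal.mul_ne_top ENNReal.coe_ne_top hfin))
    (fun m => (hH m).trans (by gcongr; exact (hκ a m).trans (by gcongr))) g₂
  refine ⟨u, IsLocalizationOf.of_pairing hu, ?_⟩
  have hneg : ∑' j, ‖g₂ (-j)‖ₑ = g₂.l1Norm := g₂.tsum_enorm_neg
  have h1 : u.seqNorm Φ₁ ≤ S * luxNorm Φ₁ Measure.count fun k => ∑' j, a (k + j) * ‖g₂ (-j)‖ₑ := by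
    refine (luxNorm_mono Φ₁ fun k => ?_).trans (luxNorm_const_mul_le Φ₁ S _)
    refine (hub k).trans ?_
    rw [← ENNReal.tsum_mul_left]
    refine ENNReal.tsum_le_tsum fun j => ?_
    rw [← mul_assoc]
    gcongr
    exact hH _
  have h2 : (luxNorm Φ₁ Measure.count fun k => ∑' j, a (k + j) * ‖g₂ (-j)‖ₑ) ≤
      2 * g₂.l1Norm * luxNorm Φ₁ Measure.count a := by
    rw [← hneg]
    exact luxNorm_tsum_mul_le Φ₁ a (fun j => ‖g₂ (-j)‖ₑ) (by rw [hneg]; exact g₂.l1Norm_ne_top)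
  calc u.seqNorm Φ₁ ≤ S * (2 * g₂.l1Norm * (K * mixedNorm Φ₁ Φ₂ ς)) := by
        refine h1.trans ?_
        gcongr
        exact h2.trans (by gcongr)
    _ = ((2 * κ * K : ℝ≥0) : ℝ≥0∞) * g₁.l1Norm * g₂.l1Norm * mixedNorm Φ₁ Φ₂ ς * f.seqNorm Φ₁ := by
        rw [hS, ENNReal.coe_mul, ENNReal.coe_mul, ENNReal.coe_ofNat]; ring

end OrliczLoc

end

/-- Since `𝕋ⁿ` has finite measure, `M^{Φ₁, Φ₂}(ℤⁿ)` is `ℓ^{Φ₁}(ℤⁿ)` with an equivalent norm, which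
embeds into `ℓ^∞`.  Of the hypotheses on the Young functions, the proof uses the continuity of `Φ₂`
only. -/
theorem mainTheorem7 (n : ℕ) (Φ₁ Ψ₁ Φ₂ Ψ₂ : OrliczLoc.YoungFunction)
    (hc₁ : OrliczLoc.IsComplementary Φ₁ Ψ₁) (hc₂ : OrliczLoc.IsComplementary Φ₂ Ψ₂)
    (hΔ₁ : OrliczLoc.LocalDelta2 Φ₁) (hΔ₂ : OrliczLoc.LocalDelta2 Φ₂)
    (hs₁ : OrliczLoc.StrictlyConvex Φ₁) (hs₂ : OrliczLoc.StrictlyConvex Φ₂)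
    (hcont₁ : Continuous Φ₁.toFun) (hcont₂ : Continuous Φ₂.toFun)
    (hd₁ : OrliczLoc.DominatedNearZero Ψ₁ Φ₁) (hd₂ : OrliczLoc.DominatedNearZero Ψ₂ Φ₂)
    (g : OrliczLoc.SchwartzZ n) (hg : g ≠ 0) :
    ∃ C : ℝ≥0, ∀ (g₁ g₂ : OrliczLoc.SchwartzZ n) (ς : OrliczLoc.Phase n → ℂ),
      OrliczLoc.MemMixedOrlicz Φ₁ Φ₂ ς →
      ∃ L : OrliczLoc.modulationSpace Φ₁ Φ₂ g →ₗ[ℂ] OrliczLoc.modulationSpace Φ₁ Φ₂ g,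
        (∀ f : OrliczLoc.modulationSpace Φ₁ Φ₂ g, OrliczLoc.IsLocalizationOf ς g₁ g₂ f (L f)) ∧
        ∀ f : OrliczLoc.modulationSpace Φ₁ Φ₂ g, OrliczLoc.modulationNorm Φ₁ Φ₂ g (L f) ≤
          C * g₁.l1Norm * g₂.l1Norm * OrliczLoc.mixedNorm Φ₁ Φ₂ ς *
            OrliczLoc.modulationNorm Φ₁ Φ₂ g f := by
  obtain ⟨K₁, hK₁⟩ := OrliczLoc.TemperedZ.exists_modulationNorm_le Φ₁ Φ₂ hcont₂ g
  obtain ⟨K₂, hK₂⟩ := OrliczLoc.TemperedZ.exists_seqNorm_le Φ₁ Φ₂ hg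
  obtain ⟨K, hK⟩ := OrliczLoc.exists_isLocalizationOf n Φ₁ Φ₂
  refine ⟨K₁ * K * K₂, fun g₁ g₂ ς hς => ?_⟩
  have hfin : ∀ f : OrliczLoc.modulationSpace Φ₁ Φ₂ g,
      OrliczLoc.TemperedZ.seqNorm Φ₁ (f : OrliczLoc.TemperedZ n) ≠ ∞ := fun f =>
    ne_top_of_le_ne_top (ENNReal.mul_ne_top ENNReal.coe_ne_top f.2.2.ne) (hK₂ f)
  choose u hu hub using fun f : OrliczLoc.modulationSpace Φ₁ Φ₂ g => hK g₁ g₂ ς hς f (hfin f)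
  have hbound : ∀ f, OrliczLoc.modulationNorm Φ₁ Φ₂ g (u f) ≤
      ((K₁ * K * K₂ : ℝ≥0) : ℝ≥0∞) * g₁.l1Norm * g₂.l1Norm * OrliczLoc.mixedNorm Φ₁ Φ₂ ς *
        OrliczLoc.modulationNorm Φ₁ Φ₂ g f := fun f =>
    calc OrliczLoc.modulationNorm Φ₁ Φ₂ g (u f)
        ≤ K₁ * (K * g₁.l1Norm * g₂.l1Norm * OrliczLoc.mixedNorm Φ₁ Φ₂ ς *
            (K₂ * OrliczLoc.modulationNorm Φ₁ Φ₂ g f)) := by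
          refine (hK₁ _).trans ?_
          gcongr
          refine (hub f).trans ?_
          gcongr
          exact hK₂ f
      _ = _ := by rw [ENNReal.coe_mul, ENNReal.coe_mul]; ring
  have hmem : ∀ f, u f ∈ OrliczLoc.modulationSpace Φ₁ Φ₂ g := fun f => by
    refine ⟨(OrliczLoc.TemperedZ.measurable_stft g (u f)).aestronglyMeasurable,
      (hbound f).trans_lt (Ne.lt_top ?_)⟩
    exact ENNReal.mul_ne_top (ENNReal.mul_ne_top (ENNReal.mul_ne_top (ENNReal.mul_ne_top
      ENNReal.coe_ne_top g₁.l1Norm_ne_top) g₂.l1Norm_ne_top) hς.2.ne) f.2.2.ne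
  exact ⟨{ toFun := fun f => ⟨u f, hmem f⟩
           map_add' := fun f f' => Subtype.ext ((hu (f + f')).unique ((hu f).add (hu f')))
           map_smul' := fun c f => Subtype.ext ((hu (c • f)).unique ((hu f).smul c)) },
    hu, hbound⟩
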